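/- Let $L$ be an oriented link in $S^3$ (with at least one component), and let $V$ be an $n\times n$ Seifert matrix of $L$ obtained from a connected Seifert surface (an integer matrix whose $(i,j)$ entry is the linking number of $x_i$ with the positive push-off of $x_j$, for a basis $x_1,\dots,x_n$ of $H_1$ of the surface). For $\omega\in S^1\subset\mathbb C$ let $\sigma_L(\omega)$ be the signature of the Hermitian matrix $W(\omega)=(1-\omega)V+(1-\omega^{-1})V^{\mathsf T}$, and put $\sigma_L=\sigma_L(-1)$. Let $\sigma_L^{\pm}(\omega)=\lim_{\theta\to0^{\pm}}\sigma_L(\omega e^{i\theta})$ be the one-sided limits, let $\mathrm{ju}^{\pm}(\omega)=\pm(\sigma_L^{\pm}(\omega)-\sigma_L(\omega))$ be the one-sided jumps, and let $\mathrm{ju}(\omega)=\mathrm{ju}^+(\omega)+\mathrm{ju}^-(\omega)$ be the total jump. Let $\Lambda=\mathbb R[t,t^{-1}]$, and write the $\Lambda$-module presented by $V-tV^{\mathsf T}$ as $$M\cong \Lambda/\langle d_1\rangle\oplus\cdots\oplus\Lambda/\langle d_k\rangle\oplus\Lambda^{n-k},$$ where $0\le k\le n$, all $d_i\in\Lambda$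 are nonzero, and $d_i\mid d_{i+1}$ for all $i<k$. For $\rho\in S^1\setminus\{\pm1\}$ let $f_\rho=t+t^{-1}-(\rho+\rho^{-1})$, and let $f_{\pm1}=t\mp1$; these are primes of $\Lambda$. Let $\phi_o(L,\rho)$, respectively $\phi_e(L,\rho)$, be the number of $i$ such that the exponent of $f_\rho$ in $d_i$ is positive and odd, respectively positive and even. Then all the one-sided limits $\sigma_L^{\pm}(\omega)$, $\omega\in S^1$, exist, only finitely many $\phi_o(L,\rho)$ are nonzero, and the following hold. 1. If $\rho\in S^1\setminus\{\pm1\}$, then $|\mathrm{ju}(\rho)|\le 2\phi_o(L,\rho)$ and $|\mathrm{ju}(\rho)|\equiv 2\phi_o(L,\rho)\pmod 4$. 2. For each of the two signs, $|\mathrm{ju}^{\pm}(-1)|\le\phi_e(L,-1)$ and $|\mathrm{ju}^{\pm}(-1)|\equiv\phi_e(L,-1)\pmod 2$. 3. Consequently, $$|\sigma_L-\sigma_L^+(1)|\le\phi_e(L,-1)+\sum_{\rho\in S^1\setminus\{-1,1\}}\phi_o(L,\rho).$$ -/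

import Mathlib

open scoped Manifold ContDiff Topology LaurentPolynomial

noncomputable section

namespace LinkSignature

/-! ### Oriented links, Seifert surfaces and Seifert matrices -/

/-- Euclidean 4-space; its unit sphere is the 3-sphere. -/
abbrev E4 : Type := EuclideanSpace ℝ (Fin 4)

/-- The determinant of four vectors of Euclidean 4-space. A tangent frame `(u, v, w)` of the
3-sphere at `q` is positively oriented iff `det4 q u v w > 0` (outward normal first). -/
def det4 (a b c d : E4) : ℝ :=
  Matrix.det (Matrix.of fun i j : Fin 4 => (![a, b, c, d] i : E4) j)

/-- An oriented (smooth, nonempty) link in the 3-sphere: finitely many disjoint smoothly embedded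
oriented circles, given by regular 1-periodic parametrizations. -/
structure OrientedLink where
  /-- the number of components -/
  components : ℕ
  components_pos : 0 < components
  /-- the parametrizations of the components -/
  curve : Fin components → ℝ → E4
  norm_eq_one : ∀ i s, ‖curve i s‖ = 1
  smooth : ∀ i, ContDiff ℝ ∞ (curve i)
  periodic : ∀ i, Function.Periodic (curve i) 1
  deriv_ne_zero : ∀ i s, deriv (curve i) s ≠ 0
  injective : ∀ i j s t, curve i s = curve j t → i = j ∧ ∃ m : ℤ, s = t + m

/-- `e : F → S³` is a smooth embedding of a compact connected surface `F` with boundary, oriented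
by the unit normal field `ν` (a tangent frame `(u, v)` of the surface is positive iff `(ν, u, v)` is
a positive frame of the 3-sphere), whose oriented boundary is the link `L`. In the last field,
tangent vectors of `F` at a boundary point `x` are read in the preferred half-plane chart
`{z | 0 ≤ z 0}` at `x`, so those with negative `0`-th coordinate are the outward pointing ones;
the boundary orientation is the one with the outward normal first. -/
structure IsSeifertSurface (L : OrientedLink) {F : Type} [TopologicalSpace F]
    [ChartedSpace (EuclideanHalfSpace 2) F] (e ν : F → E4) : Prop where
  manifold : IsManifold (𝓡∂ 2) ∞ F
  t2 : T2Space F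
  compact : CompactSpace F
  connected : ConnectedSpace F
  norm_eq_one : ∀ x, ‖e x‖ = 1
  smooth : ContMDiff (𝓡∂ 2) 𝓘(ℝ, E4) ∞ e
  injective : Function.Injective e
  immersion : ∀ x, Function.Injective (mfderiv (𝓡∂ 2) 𝓘(ℝ, E4) e x)
  normal_continuous : Continuous ν
  normal_norm : ∀ x, ‖ν x‖ = 1
  normal_tangent : ∀ x, inner ℝ (e x) (ν x) = 0
  normal_orthogonal : ∀ (x : F) (w : TangentSpace (𝓡∂ 2) x),
    inner ℝ (ν x) (mfderiv (𝓡∂ 2) 𝓘(ℝ, E4) e x w : E4) = 0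
  boundary_eq : e '' (𝓡∂ 2).boundary F = ⋃ i, Set.range (L.curve i)
  boundary_orientation : ∀ x ∈ (𝓡∂ 2).boundary F, ∀ i s, L.curve i s = e x →
    ∀ w : TangentSpace (𝓡∂ 2) x, (show EuclideanSpace ℝ (Fin 2) from w) 0 < 0 →
      0 < det4 (e x) (ν x) (mfderiv (𝓡∂ 2) 𝓘(ℝ, E4) e x w : E4) (deriv (L.curve i) s)

/-- Stereographic projection of the 3-sphere from its point `p` to the hyperplane `p^⊥`. -/
def stereo (p x : E4) : E4 := (1 - inner ℝ p x)⁻¹ • (x - (inner ℝ p x : ℝ) • p)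

/-- The Gauss linking integral
`(1 / 4π) ∫∫ ⟨X - Y, X' × Y'⟩ / |X - Y|³` of two closed curves `x, y` in the 3-sphere,
parametrized by `[0, 1]`, where `X, Y` are their stereographic projections from `p`. The
triple product of vectors `a, b, c` of `p^⊥` is `det4 (-p) a b c`, which is the orientation of
`p^⊥` for which stereographic projection from `p` preserves orientations. -/
def gaussIntegral (p : E4) (x y : ℝ → E4) : ℝ :=
  (4 * Real.pi)⁻¹ * ∫ s in (0 : ℝ)..1, ∫ t in (0 : ℝ)..1,
    det4 (-p) (stereo p (x s) - stereo p (y t))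
      (deriv (fun u => stereo p (x u)) s) (deriv (fun u => stereo p (y u)) t) /
        ‖stereo p (x s) - stereo p (y t)‖ ^ 3

/-- The disjoint closed curves `x, y` in the 3-sphere have linking number `m`. (The Gauss integral
does not depend on the point `p` off the two curves.) -/
def HasLinkingNumber (x y : ℝ → E4) (m : ℤ) : Prop :=
  (∀ s ∈ Set.Icc (0 : ℝ) 1, ∀ t ∈ Set.Icc (0 : ℝ) 1, x s ≠ y t) ∧
  ∀ p : E4, ‖p‖ = 1 → p ∉ x '' Set.Icc 0 1 → p ∉ y '' Set.Icc 0 1 →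
    gaussIntegral p x y = m

/-- The class in `H₁(F; ℤ)`, the abelianized fundamental group of the path-connected space `F`,
of a loop. -/
def homologyClass {F : Type} [TopologicalSpace F] {x₀ : F} (a : Path x₀ x₀) :
    Additive (Abelianization (FundamentalGroup F x₀)) :=
  Additive.ofMul (Abelianization.of (FundamentalGroup.fromPath (Path.Homotopic.Quotient.mk a)))

/-- `V` is a Seifert matrix of the oriented link `L`: there are a connected Seifert surface of `L`
and a basis of its first homology, represented by (continuously differentiable) loops
`a₁, …, aₙ`, such that `V i j` is the linking number of `aᵢ` with the push-off of `aⱼ`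
a small distance in the positive normal direction. -/
def IsSeifertMatrix (L : OrientedLink) {n : ℕ} (V : Matrix (Fin n) (Fin n) ℤ) : Prop :=
  ∃ (F : Type) (_ : TopologicalSpace F) (_ : ChartedSpace (EuclideanHalfSpace 2) F)
    (e ν : F → E4) (x₀ : F) (a : Fin n → Path x₀ x₀),
    IsSeifertSurface L e ν ∧
    (∀ i, ContDiffOn ℝ 1 (fun s => e ((a i).extend s)) (Set.Icc 0 1)) ∧
    LinearIndependent ℤ (fun i => homologyClass (a i)) ∧
    Submodule.span ℤ (Set.range fun i => homologyClass (a i)) = ⊤ ∧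
    ∀ i j, ∀ᶠ ε in 𝓝[>] (0 : ℝ),
      HasLinkingNumber (fun s => e ((a i).extend s))
        (fun t => Real.cos ε • e ((a j).extend t) + Real.sin ε • ν ((a j).extend t)) (V i j)

/-! ### The signature function -/

/-- The signature of a Hermitian matrix: the number of its positive eigenvalues minus the number of
its negative eigenvalues, with multiplicity. -/
def signature {n : ℕ} (A : Matrix (Fin n) (Fin n) ℂ) (hA : A.IsHermitian) : ℤ :=
  ((Finset.univ.filter fun i => 0 < hA.eigenvalues i).card : ℤ) -
    ((Finset.univ.filter fun i => hA.eigenvalues i < 0).card : ℤ)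

/-- `W(z) = (1 - z) V + (1 - z⁻¹) Vᵀ`. -/
def W {n : ℕ} (V : Matrix (Fin n) (Fin n) ℤ) (z : Circle) : Matrix (Fin n) (Fin n) ℂ :=
  (1 - (z : ℂ)) • V.map (Int.cast : ℤ → ℂ) + (1 - (z : ℂ)⁻¹) • (V.map (Int.cast : ℤ → ℂ)).transpose

theorem W_isHermitian {n : ℕ} (V : Matrix (Fin n) (Fin n) ℤ) (z : Circle) :
    (W V z).IsHermitian := by
  ext i j
  simp only [W, Matrix.conjTranspose_apply, Matrix.add_apply, Matrix.smul_apply, Matrix.map_apply,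
    Matrix.transpose_apply, smul_eq_mul, ← Circle.coe_inv, Circle.coe_inv_eq_conj]
  simp
  ring

/-- The Levine-Tristram signature function `z ↦ σ(z)` computed from the Seifert matrix `V`. -/
def sig {n : ℕ} (V : Matrix (Fin n) (Fin n) ℤ) (z : Circle) : ℤ :=
  signature (W V z) (W_isHermitian V z)

/-- The one-sided limit `σ⁺(z)` (counterclockwise side). -/
def sigPlus {n : ℕ} (V : Matrix (Fin n) (Fin n) ℤ) (z : Circle) : ℤ :=
  Filter.limUnder (𝓝[>] (0 : ℝ)) fun θ => sig V (z * Circle.exp θ)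

/-- The one-sided limit `σ⁻(z)` (clockwise side). -/
def sigMinus {n : ℕ} (V : Matrix (Fin n) (Fin n) ℤ) (z : Circle) : ℤ :=
  Filter.limUnder (𝓝[<] (0 : ℝ)) fun θ => sig V (z * Circle.exp θ)

/-- The one-sided jump `j⁺(z) = σ⁺(z) - σ(z)`. -/
def jumpPlus {n : ℕ} (V : Matrix (Fin n) (Fin n) ℤ) (z : Circle) : ℤ := sigPlus V z - sig V z

/-- The one-sided jump `j⁻(z) = -(σ⁻(z) - σ(z))`. -/
def jumpMinus {n : ℕ} (V : Matrix (Fin n) (Fin n) ℤ) (z : Circle) : ℤ := -(sigMinus V z - sig V z)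

/-- The total jump `j(z) = j⁺(z) + j⁻(z)`. -/
def jump {n : ℕ} (V : Matrix (Fin n) (Fin n) ℤ) (z : Circle) : ℤ := jumpPlus V z + jumpMinus V z

/-! ### The module and its invariant factors -/

/-- The matrix `V - t Vᵀ` over `Λ = ℝ[t, t⁻¹]`. -/
def presMatrix {n : ℕ} (V : Matrix (Fin n) (Fin n) ℤ) : Matrix (Fin n) (Fin n) ℝ[T;T⁻¹] :=
  V.map (Int.cast : ℤ → ℝ[T;T⁻¹]) -
    (LaurentPolynomial.T 1 : ℝ[T;T⁻¹]) • (V.map (Int.cast : ℤ → ℝ[T;T⁻¹])).transpose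

/-- The `Λ`-module `M` presented by `V - t Vᵀ`. -/
abbrev PresModule {n : ℕ} (V : Matrix (Fin n) (Fin n) ℤ) : Type :=
  (Fin n → ℝ[T;T⁻¹]) ⧸ LinearMap.range (presMatrix V).mulVecLin

/-- `d₁ ∣ d₂ ∣ ⋯ ∣ dₖ` are nonzero and `M ≅ Λ/⟨d₁⟩ ⊕ ⋯ ⊕ Λ/⟨dₖ⟩ ⊕ Λⁿ⁻ᵏ`. -/
structure IsInvariantFactors {n : ℕ} (V : Matrix (Fin n) (Fin n) ℤ) {k : ℕ}
    (d : Fin k → ℝ[T;T⁻¹]) : Prop where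
  le : k ≤ n
  ne_zero : ∀ i, d i ≠ 0
  dvd : ∀ i j, i ≤ j → d i ∣ d j
  iso : Nonempty (PresModule V ≃ₗ[ℝ[T;T⁻¹]]
    ((i : Fin k) → ℝ[T;T⁻¹] ⧸ Ideal.span {d i}) × (Fin (n - k) → ℝ[T;T⁻¹]))

open Classical in
/-- The prime `f_ρ` of `Λ`: `t - 1` for `ρ = 1`, `t + 1` for `ρ = -1`, and
`t + t⁻¹ - (ρ + ρ⁻¹)` otherwise (`ρ + ρ⁻¹ = 2 Re ρ`). -/
def primeAt (ρ : Circle) : ℝ[T;T⁻¹] :=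
  if ρ = 1 then LaurentPolynomial.T 1 - 1
  else if ρ = -1 then LaurentPolynomial.T 1 + 1
  else LaurentPolynomial.T 1 + LaurentPolynomial.T (-1) - LaurentPolynomial.C (2 * (ρ : ℂ).re)

open Classical in
/-- `φ_o(ρ)`: the number of `dᵢ` in which `f_ρ` has odd (positive) exponent. -/
def phiOdd {k : ℕ} (d : Fin k → ℝ[T;T⁻¹]) (ρ : Circle) : ℕ :=
  (Finset.univ.filter fun i => 0 < multiplicity (primeAt ρ) (d i) ∧
    Odd (multiplicity (primeAt ρ) (d i))).card

open Classical in
/-- `φ_e(ρ)`: the number of `dᵢ` in which `f_ρ` has positive even exponent. -/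
def phiEven {k : ℕ} (d : Fin k → ℝ[T;T⁻¹]) (ρ : Circle) : ℕ :=
  (Finset.univ.filter fun i => 0 < multiplicity (primeAt ρ) (d i) ∧
    Even (multiplicity (primeAt ρ) (d i))).card

end LinkSignature

end

/-! ### Sylvester's law of inertia -/

namespace LinkSignature

open Matrix

/-! Near a point `ρ` of the circle put `z = ρ (1 + i x) / (1 - i x)` with `x = tan (θ / 2)`. Then
`(1 + x²) W(z)` is a Hermitian matrix of polynomials in the real variable `x`. A congruence
invertible at `x = 0` makes it diagonal (`exists_diagonalize`). A nonzero real diagonal entry `ε x^e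
+ ...` has the sign of `ε x^e` near `0`, so by Sylvester's law `σ(ρ e^{iθ}) = ∑ sign(θ)^{e_i} ε_i`
for small `θ`, with `ε_i = 0` for zero entries (`eventually_sig_eq`). This gives the one-sided
limits. The total jump is twice the sum of the signs of odd order, hence its bound and its residue
modulo 4.

The orders are read off from the module. Since `W(z) = (1 - z) (V - z⁻¹ Vᵀ)`, setting `t = z⁻¹`
relates the diagonal form to `M` when `ρ ≠ 1`. Computing the dimension of the space of semilinear
maps `M → ℂ[x]/(x^m)` from the diagonal form and from the invariant factors, for all `m`, shows that
each positive order occurs as often as the same exponent of `f_ρ` among the `d_i` (`sum_min_eq`,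
`card_natTrailingDegree_eq`), because `f_ρ` becomes `x` times a unit (`cayleyHom_primeAt`).

At `-1` the symmetry `σ(z⁻¹) = σ(z)` makes the two one-sided limits equal, so only positive even
orders contribute to the one-sided jumps. For the last inequality, the upper half circle is followed
from `1` to `-1`: every point passed costs at most `2 φ_o`, conjugate points have equal `φ_o`, and
the final one-sided jump costs at most `φ_e(-1)`. -/

theorem card_pos_le_of_congruent {ι : Type*} [Fintype ι] [DecidableEq ι] (Q : Matrix ι ι ℂ)
    (lam mu : ι → ℝ)
    (h : Qᴴ * diagonal (fun i => (lam i : ℂ)) * Q = diagonal fun i => (mu i : ℂ)) :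
    (Finset.univ.filter fun i => 0 < mu i).card ≤ (Finset.univ.filter fun i => 0 < lam i).card := by
  -- Extend by zero, apply `Q`, keep the `lam`-positive coordinates. A vector in the kernel has
  -- nonpositive `lam`-form after `Q`, yet its `mu`-form is positive unless it vanishes. So `f` is
  -- injective, whether or not `Q` is invertible.
  let f : ({i // 0 < mu i} → ℂ) →ₗ[ℂ] ({i // 0 < lam i} → ℂ) :=
    LinearMap.funLeft ℂ ℂ Subtype.val ∘ₗ Q.mulVecLin ∘ₗ
      Function.ExtendByZero.linearMap ℂ Subtype.val
  have hf : Function.Injective f := by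
    rw [← LinearMap.ker_eq_bot, LinearMap.ker_eq_bot']
    intro w hw
    set v : ι → ℂ := Function.ExtendByZero.linearMap ℂ Subtype.val w with hv
    have hvi : ∀ i : {i // 0 < mu i}, v i = w i := fun i =>
      Subtype.val_injective.extend_apply _ _ _
    have hv0 : ∀ i, ¬ 0 < mu i → v i = 0 := fun i hi =>
      Function.extend_apply' _ _ _ (by rintro ⟨a, rfl⟩; exact hi a.2)
    have hQ : ∀ i, 0 < lam i → (Q *ᵥ v) i = 0 := fun i hi => congrFun hw ⟨i, hi⟩
    have key : ∑ i, mu i * ‖v i‖ ^ 2 = ∑ i, lam i * ‖(Q *ᵥ v) i‖ ^ 2 := by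
      have h1 : star v ⬝ᵥ ((diagonal fun i => (mu i : ℂ)) *ᵥ v) =
          star (Q *ᵥ v) ⬝ᵥ ((diagonal fun i => (lam i : ℂ)) *ᵥ (Q *ᵥ v)) := by
        rw [← h, ← mulVec_mulVec, ← mulVec_mulVec, dotProduct_mulVec, star_mulVec]
      have h2 : ∀ (c : ι → ℝ) (u : ι → ℂ), star u ⬝ᵥ ((diagonal fun i => (c i : ℂ)) *ᵥ u) =
          ((∑ i, c i * ‖u i‖ ^ 2 : ℝ) : ℂ) := by
        intro c u
        simp only [dotProduct, mulVec_diagonal, Pi.star_apply]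
        push_cast
        refine Finset.sum_congr rfl fun i _ => ?_
        rw [← Complex.conj_mul']
        simp only [RCLike.star_def]
        ring
      rw [h2, h2] at h1
      exact_mod_cast h1
    have hle : ∑ i, mu i * ‖v i‖ ^ 2 ≤ 0 := by
      rw [key]
      refine Finset.sum_nonpos fun i _ => ?_
      by_cases hi : 0 < lam i
      · simp [hQ i hi]
      · exact mul_nonpos_of_nonpos_of_nonneg (not_lt.1 hi) (by positivity)
    have hnn : ∀ i ∈ Finset.univ, 0 ≤ mu i * ‖v i‖ ^ 2 := fun i _ => by
      by_cases hi : 0 < mu i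
      · positivity
      · simp [hv0 i hi]
    have h0 := (Finset.sum_eq_zero_iff_of_nonneg hnn).1 (le_antisymm hle (Finset.sum_nonneg hnn))
    funext i
    have := h0 i (Finset.mem_univ _)
    have hi := i.2
    rw [← hvi i]
    simpa [hi.ne'] using this
  have := LinearMap.finrank_le_finrank_of_injective hf
  simpa [Fintype.card_subtype] using this

/-- The spectral theorem gives a second diagonal form of `A`; each form is congruent to the other,
so the inertia inequality applies in both directions, and again after negating both diagonals. -/
theorem signature_eq_sum_sign {n : ℕ} {A : Matrix (Fin n) (Fin n) ℂ} (hA : A.IsHermitian)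
    {P : Matrix (Fin n) (Fin n) ℂ} (hP : P.det ≠ 0) {mu : Fin n → ℝ}
    (h : Pᴴ * A * P = diagonal fun i => (mu i : ℂ)) :
    signature A hA = ∑ i, (SignType.sign (mu i) : ℤ) := by
  have hPu : IsUnit P.det := hP.isUnit
  set U : Matrix (Fin n) (Fin n) ℂ :=
    (hA.eigenvectorUnitary : Matrix (Fin n) (Fin n) ℂ) with hU
  have hUU : Uᴴ * U = 1 := Unitary.coe_star_mul_self hA.eigenvectorUnitary
  have hUU' : U * Uᴴ = 1 := Unitary.coe_mul_star_self hA.eigenvectorUnitary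
  have hspec : A = U * diagonal (fun i => (hA.eigenvalues i : ℂ)) * Uᴴ := by
    conv_lhs => rw [hA.spectral_theorem]
    rfl
  have h1 : (Uᴴ * P)ᴴ * diagonal (fun i => (hA.eigenvalues i : ℂ)) * (Uᴴ * P) =
      diagonal fun i => (mu i : ℂ) := by
    rw [← h, conjTranspose_mul, conjTranspose_conjTranspose]
    conv_rhs => rw [hspec]
    simp only [Matrix.mul_assoc]
  have h2 : (P⁻¹ * U)ᴴ * diagonal (fun i => (mu i : ℂ)) * (P⁻¹ * U) =
      diagonal fun i => (hA.eigenvalues i : ℂ) := by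
    have e : (Uᴴ * P) * (P⁻¹ * U) = 1 := by
      rw [Matrix.mul_assoc, ← Matrix.mul_assoc P, Matrix.mul_nonsing_inv _ hPu, Matrix.one_mul, hUU]
    rw [← h1]
    calc _ = ((Uᴴ * P) * (P⁻¹ * U))ᴴ * diagonal (fun i => (hA.eigenvalues i : ℂ)) *
          ((Uᴴ * P) * (P⁻¹ * U)) := by
          rw [conjTranspose_mul (Uᴴ * P)]; simp only [Matrix.mul_assoc]
      _ = _ := by rw [e]; simp
  have hneg : ∀ (Q : Matrix (Fin n) (Fin n) ℂ) (lam mu : Fin n → ℝ),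
      Qᴴ * diagonal (fun i => (lam i : ℂ)) * Q = diagonal (fun i => (mu i : ℂ)) →
      (Finset.univ.filter fun i => mu i < 0).card ≤
        (Finset.univ.filter fun i => lam i < 0).card := by
    intro Q lam mu h
    have := card_pos_le_of_congruent Q (fun i => -lam i) (fun i => -mu i) (by
      have e : ∀ c : Fin n → ℝ, (diagonal fun i => ((-c i : ℝ) : ℂ)) =
          -(diagonal fun i => (c i : ℂ)) := fun c => by
        rw [diagonal_neg]; congr 1; funext i; simp
      rw [e, e, Matrix.mul_neg, Matrix.neg_mul, h])
    simpa using this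
  have hs : ∀ i, (SignType.sign (mu i) : ℤ) =
      (if 0 < mu i then 1 else 0) - (if mu i < 0 then 1 else 0) := by
    intro i
    rcases lt_trichotomy (mu i) 0 with h | h | h
    · simp [h, not_lt.2 h.le]
    · simp [h]
    · simp [h, not_lt.2 h.le]
  rw [Finset.sum_congr rfl fun i _ => hs i, Finset.sum_sub_distrib, Finset.sum_boole,
    Finset.sum_boole, signature]
  rw [le_antisymm (card_pos_le_of_congruent _ _ _ h1) (card_pos_le_of_congruent _ _ _ h2),
    le_antisymm (hneg _ _ _ h1) (hneg _ _ _ h2)]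

end LinkSignature

/-! ### Diagonalizing Hermitian matrices over `ℂ[X]` near `0` -/

namespace LinkSignature

open Matrix Polynomial

/-- Conjugation of the coefficients. -/
noncomputable instance polynomialStarRing : StarRing ℂ[X] where
  star := Polynomial.map (starRingEnd ℂ)
  star_involutive p := by
    rw [Polynomial.map_map]
    convert Polynomial.map_id
    ext x
    simp
  star_mul p q := by
    change (p * q).map (starRingEnd ℂ) = _
    rw [Polynomial.map_mul, mul_comm]
  star_add p q := Polynomial.map_add _

theorem star_eq_map (p : ℂ[X]) : star p = p.map (starRingEnd ℂ) := rfl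

@[simp]
theorem coeff_star (p : ℂ[X]) (m : ℕ) : (star p).coeff m = star (p.coeff m) := by
  simp [star_eq_map]

@[simp]
theorem star_X : star (X : ℂ[X]) = X := by simp [star_eq_map]

@[simp]
theorem star_C (c : ℂ) : star (C c) = C (star c) := by simp [star_eq_map]

/-- The involution fixes `X`, so the indeterminate plays the role of a real variable, and the
evaluation point has to be real. -/
theorem eval_star (p : ℂ[X]) (x : ℝ) : (star p).eval (x : ℂ) = star (p.eval (x : ℂ)) := by
  rw [star_eq_map, ← Complex.conj_ofReal x, Polynomial.eval_map_apply]
  simp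

theorem map_eval_conjTranspose {ι : Type*} (P : Matrix ι ι ℂ[X]) (x : ℝ) :
    (Pᴴ).map (eval (x : ℂ)) = (P.map (eval (x : ℂ)))ᴴ := by
  ext i j
  simp [eval_star]

theorem map_eval_mul {ι : Type*} [Fintype ι] (P Q : Matrix ι ι ℂ[X]) (x : ℂ) :
    (P * Q).map (eval x) = P.map (eval x) * Q.map (eval x) :=
  Matrix.map_mul (f := Polynomial.evalRingHom x)

variable {ι : Type*} [Fintype ι] [DecidableEq ι]

theorem eval_det_eq (P : Matrix ι ι ℂ[X]) (x : ℂ) :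
    P.det.eval x = (P.map (eval x)).det := by
  have := RingHom.map_det (Polynomial.evalRingHom x) P
  simpa using this

/-- Clearing the row of a pivot `G j j`. -/
theorem exists_clear_pivot {G : Matrix ι ι ℂ[X]} (hG : G.IsHermitian) {s : Finset ι}
    (hs : ∀ i ∈ s, ∀ k, k ≠ i → G i k = 0) {j : ι} (hj : j ∉ s) {m : ℕ}
    (hdvd : ∀ k, X ^ m ∣ G j k) (hne : (G j j).coeff m ≠ 0) :
    ∃ Q : Matrix ι ι ℂ[X], Q.det.eval 0 ≠ 0 ∧
      ∀ i ∈ insert j s, ∀ k, k ≠ i → (Qᴴ * G * Q) i k = 0 := by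
  choose g hg using hdvd
  have hg0 : (g j).eval 0 ≠ 0 := by
    rw [hg j, coeff_X_pow_mul'] at hne
    simpa [coeff_zero_eq_eval_zero] using hne
  have hgs : ∀ i ∈ s, g i = 0 := by
    intro i hi
    have h1 : G j i = 0 := by
      rw [← hG.apply j i, hs i hi j (by rintro rfl; exact hj hi), star_zero]
    rw [hg i] at h1
    simpa using h1
  -- Fraction-free elimination: column `i ≠ j` is `g j • e_i - g i • e_j`. Using `g` in place of the
  -- row `G j` divides out `X ^ m`, and `g j` is nonzero at `0`, which keeps `Q` invertible there.
  let Q : Matrix ι ι ℂ[X] := Matrix.of fun a i =>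
    if i = j then (if a = j then 1 else 0)
    else if a = i then g j else if a = j then -g i else 0
  have hGQ : ∀ a k, k ≠ j → (G * Q) a k = G a k * g j - G a j * g k := by
    intro a k hk
    rw [Matrix.mul_apply, Finset.sum_eq_add k j hk]
    · simp [Q, hk, hk.symm]; ring
    · rintro c - ⟨h1, h2⟩; simp [Q, hk, h1, h2]
    · simp
    · simp
  have hGQj : ∀ a, (G * Q) a j = G a j := by
    intro a
    simp [Matrix.mul_apply, Q]
  refine ⟨Q, ?_, ?_⟩
  · rw [eval_det_eq]
    intro h0
    obtain ⟨v, hv, hv0⟩ := Matrix.exists_mulVec_eq_zero_iff.2 h0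
    apply hv
    have h1 : ∀ a, a ≠ j → v a = 0 := by
      intro a ha
      have h2 := congrFun hv0 a
      rw [mulVec, dotProduct, Finset.sum_eq_single a] at h2
      · simpa [Q, ha, hg0] using h2
      · intro c _ hc
        by_cases hcj : c = j
        · simp [Q, hcj, ha]
        · simp [Q, hcj, ha, hc.symm]
      · simp
    funext a
    by_cases ha : a = j
    · subst ha
      have h2 := congrFun hv0 a
      rw [mulVec, dotProduct, Finset.sum_eq_single a] at h2
      · simpa [Q] using h2
      · intro c _ hc
        simp [h1 c hc]
      · simp
    · simp [h1 a ha]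
  · intro i hi k hk
    rw [Matrix.mul_assoc, Matrix.mul_apply]
    rcases Finset.mem_insert.1 hi with rfl | hi'
    · rw [Finset.sum_eq_single i]
      · rw [hGQ i k hk, hg k, hg i]; ring
      · intro c _ hc; simp [Q, hc]
      · simp
    · have hij : i ≠ j := by rintro rfl; exact hj hi'
      rw [Finset.sum_eq_single i]
      · by_cases hkj : k = j
        · subst hkj; rw [hGQj, hs i hi' k hk, mul_zero]
        · rw [hGQ i k hkj, hs i hi' k hk, hs i hi' j hij.symm]; simp
      · intro c _ hc
        by_cases hcj : c = j
        · simp [Q, hij, hcj, hij.symm, hgs i hi']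
        · simp [Q, hij, hcj, hc]
      · simp

/-- Among the rows outside `s` one can arrange a diagonal pivot of minimal order. -/
theorem exists_pivot {G : Matrix ι ι ℂ[X]} (hG : G.IsHermitian) {s : Finset ι}
    (hs : ∀ i ∈ s, ∀ k, k ≠ i → G i k = 0) {a b : ι} (ha : a ∉ s) (hb : b ∉ s) {m : ℕ}
    (hdvd : ∀ i ∉ s, ∀ k ∉ s, X ^ m ∣ G i k) (hne : (G a b).coeff m ≠ 0) :
    ∃ Q : Matrix ι ι ℂ[X], Q.det.eval 0 ≠ 0 ∧
      (∀ i ∈ s, ∀ k, k ≠ i → (Qᴴ * G * Q) i k = 0) ∧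
      ∃ j ∉ s, (∀ k, X ^ m ∣ (Qᴴ * G * Q) j k) ∧ ((Qᴴ * G * Q) j j).coeff m ≠ 0 := by
  have hdvd' : ∀ i ∉ s, ∀ k, X ^ m ∣ G i k := by
    intro i hi k
    by_cases hk : k ∈ s
    · rw [← hG.apply i k, hs k hk i (by rintro rfl; exact hi hk), star_zero]
      exact dvd_zero _
    · exact hdvd i hi k hk
  by_cases hdiag : ∃ i ∉ s, (G i i).coeff m ≠ 0
  · obtain ⟨i, hi, hne⟩ := hdiag
    exact ⟨1, by simp, by simpa using hs, i, hi, by simpa using hdvd' i hi, by simpa using hne⟩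
  push Not at hdiag
  have hab : a ≠ b := by rintro rfl; exact hne (hdiag a ha)
  set g := (G a b).coeff m with hgdef
  -- All diagonal coefficients of order `m` vanish here, so polarization is used: after adding `c`
  -- times column `b` to column `a`, and likewise for rows, the coefficient at `(a, a)` is `2 * (g *
  -- star g)`. The conjugate prevents the two cross terms from cancelling.
  let c : ℂ[X] := C (star g)
  have hcs : star c = C g := by simp [c]
  let Q : Matrix ι ι ℂ[X] := transvection b a c
  have hGQ : ∀ i k, (G * Q) i k = G i k + if k = a then G i b * c else 0 := by
    intro i k
    by_cases hk : k = a
    · subst hk; simp [Q, transvection, Matrix.mul_add]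
    · simp [Q, transvection, Matrix.mul_add, hk, Matrix.mul_single_apply_of_ne]
  have hQGQ : ∀ (i k) (N : Matrix ι ι ℂ[X]), (Qᴴ * N) i k =
      N i k + if i = a then star c * N b k else 0 := by
    intro i k N
    by_cases hi : i = a
    · subst hi
      simp [Q, transvection, Matrix.add_mul]
    · simp [Q, transvection, Matrix.add_mul, hi, Matrix.single_mul_apply_of_ne]
  refine ⟨Q, ?_, ?_, a, ha, ?_, ?_⟩
  · rw [det_transvection_of_ne _ _ hab.symm]; simp
  · intro i hi k hk
    have hia : i ≠ a := by rintro rfl; exact ha hi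
    have hib : b ≠ i := by rintro rfl; exact hb hi
    rw [Matrix.mul_assoc, hQGQ, hGQ, hs i hi k hk, hs i hi b hib]
    simp [hia]
  · intro k
    rw [Matrix.mul_assoc, hQGQ, hGQ, hGQ, if_pos rfl]
    have h1 : ∀ i ∉ s, X ^ m ∣ (if k = a then G i b * c else 0) := fun i hi => by
      split_ifs
      · exact (hdvd' i hi b).mul_right _
      · exact dvd_zero _
    exact dvd_add (dvd_add (hdvd' a ha k) (h1 a ha))
      ((dvd_add (hdvd' b hb k) (h1 b hb)).mul_left _)
  · rw [Matrix.mul_assoc, hQGQ, hGQ, hGQ, if_pos rfl, if_pos rfl, if_pos rfl, hcs]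
    have hba : (G b a).coeff m = star g := by
      rw [← hG.apply b a, coeff_star]
    have e : (G a a + G a b * c + C g * (G b a + G b b * c)).coeff m = 2 * (g * star g) := by
      simp only [c, coeff_add, coeff_mul_C, coeff_C_mul, hdiag a ha, hdiag b hb, hba, ← hgdef]
      ring
    rw [e]
    simp [hne]

/-- The localization of `ℂ[X]` at `0` is a valuation ring: an entry of least order in the remaining
block divides all others up to units at `0`, so it can serve as pivot. If the block is zero, any
further row is already clear. -/
theorem exists_clear_step {G : Matrix ι ι ℂ[X]} (hG : G.IsHermitian) {s : Finset ι}
    (hs : ∀ i ∈ s, ∀ k, k ≠ i → G i k = 0) (hsu : s ≠ Finset.univ) :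
    ∃ Q : Matrix ι ι ℂ[X], Q.det.eval 0 ≠ 0 ∧ ∃ j ∉ s,
      ∀ i ∈ insert j s, ∀ k, k ≠ i → (Qᴴ * G * Q) i k = 0 := by
  by_cases h0 : ∀ i ∉ s, ∀ k ∉ s, G i k = 0
  · obtain ⟨j, hj⟩ : ∃ j, j ∉ s := by
      by_contra! h
      exact hsu (Finset.eq_univ_iff_forall.2 h)
    refine ⟨1, by simp, j, hj, ?_⟩
    intro i hi k hk
    simp only [conjTranspose_one, Matrix.one_mul, Matrix.mul_one]
    rcases Finset.mem_insert.1 hi with rfl | hi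
    · by_cases hks : k ∈ s
      · rw [← hG.apply i k, hs k hks i hk.symm, star_zero]
      · exact h0 _ hj _ hks
    · exact hs i hi k hk
  · push Not at h0
    obtain ⟨i₀, hi₀, k₀, hk₀, hne₀⟩ := h0
    obtain ⟨⟨a, b⟩, hab, hmin⟩ := Finset.exists_min_image
      (Finset.univ.filter fun q : ι × ι => q.1 ∉ s ∧ q.2 ∉ s ∧ G q.1 q.2 ≠ 0)
      (fun q => (G q.1 q.2).natTrailingDegree) ⟨(i₀, k₀), by simp [hi₀, hk₀, hne₀]⟩
    simp only [Finset.mem_filter, Finset.mem_univ, true_and] at hab hmin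
    obtain ⟨ha, hb, hne⟩ := hab
    obtain ⟨Q, hQ, hQs, j, hj, hjd, hjj⟩ := exists_pivot hG hs ha hb
      (m := (G a b).natTrailingDegree) (fun i hi k hk => by
        rw [X_pow_dvd_iff]
        intro d hd
        by_cases hik : G i k = 0
        · simp [hik]
        · exact coeff_eq_zero_of_lt_natTrailingDegree
            (hd.trans_le (hmin (i, k) ⟨hi, hk, hik⟩)))
      (by rwa [← Polynomial.trailingCoeff, Ne, Polynomial.trailingCoeff_eq_zero])
    obtain ⟨R, hR, hRs⟩ := exists_clear_pivot (G := Qᴴ * G * Q)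
      (Matrix.isHermitian_conjTranspose_mul_mul Q hG) hQs hj hjd hjj
    refine ⟨Q * R, by simp [hQ, hR], j, hj, ?_⟩
    intro i hi k hk
    have := hRs i hi k hk
    rw [conjTranspose_mul]
    simpa only [Matrix.mul_assoc] using this

/-- A Hermitian matrix over `ℂ[X]` is diagonalized by a congruence that is invertible at `0`. -/
theorem exists_diagonalize {H : Matrix ι ι ℂ[X]} (hH : H.IsHermitian) :
    ∃ (P : Matrix ι ι ℂ[X]) (h : ι → ℂ[X]), P.det.eval 0 ≠ 0 ∧ Pᴴ * H * P = diagonal h ∧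
      ∀ i, star (h i) = h i := by
  have key : ∀ r ≤ Fintype.card ι, ∃ (P : Matrix ι ι ℂ[X]) (s : Finset ι), P.det.eval 0 ≠ 0 ∧
      s.card = r ∧ ∀ i ∈ s, ∀ k, k ≠ i → (Pᴴ * H * P) i k = 0 := by
    intro r
    induction r with
    | zero => exact fun _ => ⟨1, ∅, by simp, by simp, by simp⟩
    | succ r ih =>
      intro hr
      obtain ⟨P, s, hP, hsr, hs⟩ := ih (by omega)
      obtain ⟨Q, hQ, j, hj, hQs⟩ := exists_clear_step
        (Matrix.isHermitian_conjTranspose_mul_mul P hH) hs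
        (by rintro rfl; rw [Finset.card_univ] at hsr; omega)
      refine ⟨P * Q, insert j s, by simp [hP, hQ], by rw [Finset.card_insert_of_notMem hj, hsr], ?_⟩
      intro i hi k hk
      rw [conjTranspose_mul]
      simpa only [Matrix.mul_assoc] using hQs i hi k hk
  obtain ⟨P, s, hP, hsr, hs⟩ := key _ le_rfl
  have hsu : s = Finset.univ := Finset.card_eq_iff_eq_univ s |>.1 hsr
  subst hsu
  refine ⟨P, fun i => (Pᴴ * H * P) i i, hP, ?_, fun i => ?_⟩
  · ext1 i k
    by_cases hik : i = k
    · subst hik; simp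
    · rw [diagonal_apply_ne _ hik, hs i (Finset.mem_univ _) k (Ne.symm hik)]
  · exact (Matrix.isHermitian_conjTranspose_mul_mul P hH).apply i i

end LinkSignature

/-! ### The Cayley parametrization and the local shape of the signature -/

namespace LinkSignature

open Matrix Polynomial

/-- Numerator of the Cayley parametrization `ρ (1 + i x) / (1 - i x)` of the circle. -/
noncomputable def cayleyNum (ρ : Circle) : ℂ[X] := C (ρ : ℂ) * (1 + C Complex.I * X)

/-- Denominator of the Cayley parametrization `ρ (1 + i x) / (1 - i x)` of the circle. -/
noncomputable def cayleyDen : ℂ[X] := 1 - C Complex.I * X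

theorem star_cayleyNum (ρ : Circle) :
    star (cayleyNum ρ) = C ((ρ : ℂ)⁻¹) * (1 - C Complex.I * X) := by
  rw [← Circle.coe_inv, Circle.coe_inv_eq_conj]
  simp [cayleyNum]
  ring

theorem star_cayleyDen : star cayleyDen = 1 + C Complex.I * X := by
  simp [cayleyDen]

theorem C_mul_C_inv (ρ : Circle) : (C (ρ : ℂ) * C ((ρ : ℂ)⁻¹) : ℂ[X]) = 1 := by
  rw [← C_mul, mul_inv_cancel₀ (Circle.coe_ne_zero ρ), C_1]

/-- The matrix `(1 + x²) W(z)` at `z = ρ (1 + i x) / (1 - i x)`, as a polynomial in `x`. -/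
noncomputable def cayleyW {n : ℕ} (V : Matrix (Fin n) (Fin n) ℤ) (ρ : Circle) :
    Matrix (Fin n) (Fin n) ℂ[X] :=
  (cayleyDen - cayleyNum ρ) •
    (star cayleyDen • V.map (Int.cast : ℤ → ℂ[X]) -
      star (cayleyNum ρ) • (V.map (Int.cast : ℤ → ℂ[X]))ᵀ)

theorem cayleyW_isHermitian {n : ℕ} (V : Matrix (Fin n) (Fin n) ℤ) (ρ : Circle) :
    (cayleyW V ρ).IsHermitian := by
  ext1 i j
  have h := C_mul_C_inv ρ
  simp only [cayleyW, conjTranspose_apply, Matrix.smul_apply, Matrix.sub_apply, Matrix.map_apply,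
    transpose_apply, smul_eq_mul, star_mul', star_sub, star_star, star_intCast]
  simp only [star_cayleyDen, star_cayleyNum]
  simp only [cayleyDen, cayleyNum]
  -- The two sides differ by a multiple of `num * star num - den * star den`, which vanishes because
  -- `ρ ρ⁻¹ = 1`.
  linear_combination (1 - C Complex.I * X) * (1 + C Complex.I * X) * ((V i j : ℂ[X]) - V j i) * h

/-- The parameter `x = tan (θ / 2)`. -/
theorem cayleyW_eval {n : ℕ} (V : Matrix (Fin n) (Fin n) ℤ) (ρ : Circle) {θ : ℝ}
    (hθ : Real.cos (θ / 2) ≠ 0) :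
    (cayleyW V ρ).map (eval ((Real.tan (θ / 2) : ℝ) : ℂ)) =
      ((1 + Real.tan (θ / 2) ^ 2 : ℝ) : ℂ) • W V (ρ * Circle.exp θ) := by
  set x : ℝ := Real.tan (θ / 2) with hx
  have hc : (Complex.cos (θ / 2 : ℝ)) ≠ 0 := by rw [← Complex.ofReal_cos]; exact_mod_cast hθ
  have hs : Complex.sin (θ / 2 : ℝ) = x * Complex.cos (θ / 2 : ℝ) := by
    rw [hx, Complex.ofReal_tan, Complex.tan_mul_cos hc]
  have h1 : Complex.exp (Complex.I * (θ / 2 : ℝ)) =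
      Complex.cos (θ / 2 : ℝ) * (1 + Complex.I * x) := by
    rw [mul_comm, Complex.exp_mul_I, hs]; ring
  have h2 : Complex.exp (-(Complex.I * (θ / 2 : ℝ))) =
      Complex.cos (θ / 2 : ℝ) * (1 - Complex.I * x) := by
    rw [show -(Complex.I * (θ / 2 : ℝ)) = (-(θ / 2 : ℝ) : ℂ) * Complex.I by ring,
      Complex.exp_mul_I, Complex.cos_neg, Complex.sin_neg, hs]; ring
  have hb : (1 - Complex.I * x : ℂ) ≠ 0 := by
    intro h; rw [h, mul_zero] at h2; exact Complex.exp_ne_zero _ h2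
  have ha : (1 + Complex.I * x : ℂ) ≠ 0 := by
    intro h; rw [h, mul_zero] at h1; exact Complex.exp_ne_zero _ h1
  have hz : ((ρ * Circle.exp θ : Circle) : ℂ) =
      ρ * ((1 + Complex.I * x) / (1 - Complex.I * x)) := by
    rw [Circle.coe_mul, Circle.coe_exp]
    congr 1
    rw [eq_div_iff hb]
    apply mul_left_cancel₀ hc
    rw [mul_left_comm, ← h2, ← h1, ← Complex.exp_add]
    congr 1
    push_cast
    ring
  have hρ := Circle.coe_ne_zero ρ
  have hI : (1 + (x : ℂ) ^ 2) = (1 + Complex.I * x) * (1 - Complex.I * x) := by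
    linear_combination (x : ℂ) ^ 2 * Complex.I_sq
  ext i j
  simp only [W, cayleyW, Matrix.map_apply, Matrix.smul_apply, Matrix.sub_apply, Matrix.add_apply,
    transpose_apply, smul_eq_mul, hz, star_cayleyDen, star_cayleyNum]
  simp only [cayleyDen, cayleyNum]
  push_cast
  rw [hI]
  simp only [eval_mul, eval_sub, eval_add, eval_one, eval_C, eval_X, eval_intCast]
  field_simp
  ring

/-- At a real point self-conjugate polynomials have real values, and the positive factor `1 + x ^ 2`
does not affect signs, so Sylvester's law applies to the evaluated congruence. -/
theorem sig_eq_sum_sign {n : ℕ} (V : Matrix (Fin n) (Fin n) ℤ) (ρ : Circle)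
    {P : Matrix (Fin n) (Fin n) ℂ[X]} {h : Fin n → ℂ[X]}
    (hPh : Pᴴ * cayleyW V ρ * P = diagonal h) (hh : ∀ i, star (h i) = h i) {θ : ℝ}
    (hθ : Real.cos (θ / 2) ≠ 0) (hP : P.det.eval ((Real.tan (θ / 2) : ℝ) : ℂ) ≠ 0) :
    sig V (ρ * Circle.exp θ) =
      ∑ i, (SignType.sign ((h i).eval ((Real.tan (θ / 2) : ℝ) : ℂ)).re : ℤ) := by
  set x : ℝ := Real.tan (θ / 2) with hx
  have hx1 : (0 : ℝ) < 1 + x ^ 2 := by positivity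
  have hreal : ∀ i, (h i).eval (x : ℂ) = (((h i).eval (x : ℂ)).re : ℂ) := fun i => by
    refine (Complex.conj_eq_iff_re.1 ?_).symm
    have := eval_star (h i) x
    rw [hh i] at this
    exact this.symm
  have e : (P.map (eval (x : ℂ)))ᴴ * W V (ρ * Circle.exp θ) * P.map (eval (x : ℂ)) =
      diagonal fun i => ((((1 + x ^ 2)⁻¹ * ((h i).eval (x : ℂ)).re : ℝ)) : ℂ) := by
    have h1 := congrArg (fun M => M.map (eval (x : ℂ))) hPh
    simp only [map_eval_mul, map_eval_conjTranspose, hx, cayleyW_eval V ρ hθ] at h1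
    rw [← hx] at h1
    rw [Matrix.mul_smul, Matrix.smul_mul] at h1
    have h2 := congrArg (fun M => ((((1 + x ^ 2)⁻¹ : ℝ)) : ℂ) • M) h1
    simp only [smul_smul] at h2
    rw [← Complex.ofReal_mul, inv_mul_cancel₀ hx1.ne', Complex.ofReal_one, one_smul] at h2
    rw [h2]
    ext i j
    by_cases hij : i = j
    · subst hij
      simp only [Matrix.smul_apply, Matrix.map_apply, diagonal_apply_eq, smul_eq_mul,
        Complex.ofReal_mul]
      rw [← hreal i]
    · simp [hij]
  rw [sig, signature_eq_sum_sign (W_isHermitian V _) (P := P.map (eval (x : ℂ))) ?_ e]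
  · refine Finset.sum_congr rfl fun i _ => ?_
    rw [sign_mul, sign_pos (inv_pos.2 hx1), one_mul]
  · rwa [← eval_det_eq]

/-- The sign of the lowest coefficient. -/
noncomputable def lowSign (p : ℂ[X]) : ℤ := SignType.sign p.trailingCoeff.re

theorem lowSign_zero : lowSign 0 = 0 := by simp [lowSign]

theorem trailingCoeff_real {p : ℂ[X]} (hp : star p = p) :
    ((p.trailingCoeff.re : ℝ) : ℂ) = p.trailingCoeff := by
  refine Complex.conj_eq_iff_re.1 ?_
  conv_rhs => rw [trailingCoeff, ← hp]
  rw [coeff_star, trailingCoeff, hp]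
  rfl

theorem abs_lowSign {p : ℂ[X]} (hp : star p = p) (h0 : p ≠ 0) : |lowSign p| = 1 := by
  have h1 : p.trailingCoeff.re ≠ 0 := fun h => by
    have := trailingCoeff_real hp
    rw [h, Complex.ofReal_zero] at this
    exact h0 (trailingCoeff_eq_zero.1 this.symm)
  rcases lt_or_gt_of_ne h1 with h | h <;> simp [lowSign, h]

theorem exists_eq_X_pow_mul (p : ℂ[X]) :
    ∃ u : ℂ[X], p = X ^ p.natTrailingDegree * u ∧ u.eval 0 = p.trailingCoeff := by
  obtain ⟨u, hu⟩ : X ^ p.natTrailingDegree ∣ p :=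
    X_pow_dvd_iff.2 fun d hd => coeff_eq_zero_of_lt_natTrailingDegree hd
  refine ⟨u, hu, ?_⟩
  have : p.trailingCoeff = (X ^ p.natTrailingDegree * u).coeff p.natTrailingDegree := by
    rw [← hu]; rfl
  rw [this, coeff_X_pow_mul', if_pos le_rfl, Nat.sub_self, coeff_zero_eq_eval_zero]

theorem eventually_sign_eval {p : ℂ[X]} (hp : star p = p) :
    ∀ᶠ x : ℝ in 𝓝 0, (SignType.sign (p.eval (x : ℂ)).re : ℤ) =
      (SignType.sign x : ℤ) ^ p.natTrailingDegree * lowSign p := by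
  -- The zero polynomial has trailing degree `0` by convention, but its `lowSign` is `0`, so it
  -- contributes nothing.
  by_cases h0 : p = 0
  · simp [h0, lowSign_zero]
  obtain ⟨u, hu, hu0⟩ := exists_eq_X_pow_mul p
  have hre : p.trailingCoeff.re ≠ 0 := fun h => by
    have := trailingCoeff_real hp
    rw [h, Complex.ofReal_zero] at this
    exact h0 (trailingCoeff_eq_zero.1 this.symm)
  have hcont : Filter.Tendsto (fun x : ℝ => (u.eval (x : ℂ)).re) (𝓝 0)
      (𝓝 p.trailingCoeff.re) := by
    have : Continuous fun x : ℝ => (u.eval (x : ℂ)).re :=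
      Complex.continuous_re.comp (u.continuous.comp Complex.continuous_ofReal)
    have h1 := this.tendsto 0
    simpa [hu0] using h1
  have hsign : ∀ᶠ x : ℝ in 𝓝 0,
      SignType.sign (u.eval (x : ℂ)).re = SignType.sign p.trailingCoeff.re := by
    rcases lt_or_gt_of_ne hre with h | h
    · filter_upwards [hcont.eventually_lt_const h] with x hx
      rw [sign_neg h, sign_neg hx]
    · filter_upwards [hcont.eventually_const_lt h] with x hx
      rw [sign_pos h, sign_pos hx]
  filter_upwards [hsign] with x hx
  have e : (p.eval (x : ℂ)).re = x ^ p.natTrailingDegree * (u.eval (x : ℂ)).re := by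
    conv_lhs => rw [hu]
    rw [eval_mul, eval_pow, eval_X, ← Complex.ofReal_pow, Complex.re_ofReal_mul]
  rw [e, sign_mul, sign_pow, hx, lowSign]
  push_cast
  rfl

/-- The signature function near `ρ` in terms of a diagonalization. -/
theorem eventually_sig_eq {n : ℕ} (V : Matrix (Fin n) (Fin n) ℤ) (ρ : Circle)
    {P : Matrix (Fin n) (Fin n) ℂ[X]} {h : Fin n → ℂ[X]} (hP : P.det.eval 0 ≠ 0)
    (hPh : Pᴴ * cayleyW V ρ * P = diagonal h) (hh : ∀ i, star (h i) = h i) :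
    ∀ᶠ θ : ℝ in 𝓝 0, sig V (ρ * Circle.exp θ) =
      ∑ i, (SignType.sign θ : ℤ) ^ (h i).natTrailingDegree * lowSign (h i) := by
  have hcos : ∀ᶠ θ : ℝ in 𝓝 0, 0 < Real.cos (θ / 2) := by
    have : Filter.Tendsto (fun θ : ℝ => Real.cos (θ / 2)) (𝓝 0) (𝓝 1) := by
      have : Continuous fun θ : ℝ => Real.cos (θ / 2) := by fun_prop
      simpa using this.tendsto 0
    exact this.eventually_const_lt one_pos
  have htan : Filter.Tendsto (fun θ : ℝ => Real.tan (θ / 2)) (𝓝 0) (𝓝 0) := by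
    have h1 : ContinuousAt Real.tan (0 / 2) := Real.continuousAt_tan.2 (by simp)
    have h2 : ContinuousAt (fun θ : ℝ => θ / 2) 0 := by fun_prop
    have := ContinuousAt.comp (x := (0 : ℝ)) (f := fun θ : ℝ => θ / 2) h1 h2
    simpa [ContinuousAt, Function.comp_def] using this
  have hdet : ∀ᶠ x : ℝ in 𝓝 0, P.det.eval (x : ℂ) ≠ 0 := by
    have : Continuous fun x : ℝ => P.det.eval (x : ℂ) :=
      P.det.continuous.comp Complex.continuous_ofReal
    have h1 := this.tendsto 0
    rw [Complex.ofReal_zero] at h1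
    exact h1.eventually_ne hP
  have hsgn := Filter.eventually_all.2 fun i => eventually_sign_eval (hh i)
  have hsin : ∀ᶠ θ : ℝ in 𝓝 0, SignType.sign (Real.tan (θ / 2)) = SignType.sign θ := by
    filter_upwards [Ioo_mem_nhds (neg_lt_zero.2 Real.pi_pos) Real.pi_pos] with θ hθ
    rcases lt_trichotomy θ 0 with h | h | h
    · rw [sign_neg h, sign_neg (Real.tan_neg_of_neg_of_pi_div_two_lt (by linarith)
        (by linarith [hθ.1]))]
    · simp [h]
    · rw [sign_pos h, sign_pos (Real.tan_pos_of_pos_of_lt_pi_div_two (by linarith)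
        (by linarith [hθ.2]))]
  filter_upwards [hcos, htan.eventually hdet, htan.eventually hsgn, hsin] with θ h1 h2 h3 h4
  rw [sig_eq_sum_sign V ρ hPh hh h1.ne' h2]
  exact Finset.sum_congr rfl fun i _ => by rw [h3 i, h4]

end LinkSignature

/-! ### Dimension counts over `ℂ[X] / (X ^ m)` -/

namespace LinkSignature

open Matrix Polynomial

/-- The ring `ℂ[X] / (X ^ m)`. -/
abbrev TruncPoly (m : ℕ) : Type := ℂ[X] ⧸ Ideal.span {(X : ℂ[X]) ^ m}

/-- Reduction modulo `X ^ m`. -/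
noncomputable abbrev truncMk (m : ℕ) : ℂ[X] →+* TruncPoly m := Ideal.Quotient.mk _

theorem truncMk_eq_zero_iff {m : ℕ} {p : ℂ[X]} : truncMk m p = 0 ↔ X ^ m ∣ p := by
  rw [Ideal.Quotient.eq_zero_iff_mem, Ideal.mem_span_singleton]

theorem isUnit_truncMk (m : ℕ) {p : ℂ[X]} (hp : p.eval 0 ≠ 0) : IsUnit (truncMk m p) := by
  have h1 : IsCoprime (X : ℂ[X]) p := (irreducible_X.coprime_iff_not_dvd).2 fun h => by
    rw [X_dvd_iff, coeff_zero_eq_eval_zero] at h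
    exact hp h
  obtain ⟨a, b, hab⟩ := h1.pow_left (m := m)
  refine IsUnit.of_mul_eq_one (truncMk m b) ?_
  rw [← map_mul, ← map_one (truncMk m), ← hab, ← sub_eq_zero, ← map_sub, truncMk_eq_zero_iff]
  exact ⟨-a, by ring⟩

instance finiteTruncPoly (m : ℕ) : Module.Finite ℂ (TruncPoly m) :=
  Module.Finite.of_basis (AdjoinRoot.powerBasis' (monic_X_pow m)).basis

theorem finrank_truncPoly (m : ℕ) : Module.finrank ℂ (TruncPoly m) = m := by
  rw [finrank_quotient_span_eq_natDegree, natDegree_X_pow]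

theorem finrank_ker_mul_X_pow (m e : ℕ) :
    Module.finrank ℂ (LinearMap.ker (LinearMap.mulLeft ℂ (truncMk m (X ^ e)))) = min m e := by
  rcases le_total m e with h | h
  · have h0 : truncMk m (X ^ e) = 0 := truncMk_eq_zero_iff.2 (pow_dvd_pow _ h)
    rw [h0, LinearMap.mulLeft_zero_eq_zero, LinearMap.ker_zero, finrank_top, finrank_truncPoly,
      min_eq_left h]
  · rw [min_eq_right h]
    -- For `e ≤ m` the kernel consists of the multiples of `X ^ (m - e)`, and multiplication by that
    -- power identifies it with `ℂ[X] / (X ^ e)`.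
    let f : TruncPoly e →ₗ[ℂ[X]] TruncPoly m :=
      Submodule.mapQ _ _ (LinearMap.mulLeft ℂ[X] (X ^ (m - e))) (by
        intro p hp
        obtain ⟨q, rfl⟩ := Ideal.mem_span_singleton.1 hp
        refine Ideal.mem_span_singleton.2 ⟨q, ?_⟩
        rw [LinearMap.mulLeft_apply, ← mul_assoc, ← pow_add, Nat.sub_add_cancel h])
    have hf : ∀ p, f (truncMk e p) = truncMk m (X ^ (m - e) * p) := fun p => rfl
    have hX : ∀ r, (X : ℂ[X]) ^ r ≠ 0 := fun r => pow_ne_zero _ X_ne_zero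
    have hinj : Function.Injective (f.restrictScalars ℂ) := by
      rw [← LinearMap.ker_eq_bot, LinearMap.ker_eq_bot']
      intro y hy
      obtain ⟨p, rfl⟩ := Ideal.Quotient.mk_surjective y
      have h1 : truncMk m (X ^ (m - e) * p) = 0 := hy
      rw [truncMk_eq_zero_iff] at h1
      refine truncMk_eq_zero_iff.2 ?_
      rw [← Nat.sub_add_cancel h, pow_add] at h1
      exact (mul_dvd_mul_iff_left (hX _)).1 (by simpa using h1)
    have hrange : LinearMap.ker (LinearMap.mulLeft ℂ (truncMk m (X ^ e))) =
        LinearMap.range (f.restrictScalars ℂ) := by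
      ext y
      obtain ⟨p, rfl⟩ := Ideal.Quotient.mk_surjective y
      rw [LinearMap.mem_ker, LinearMap.mulLeft_apply, ← map_mul, truncMk_eq_zero_iff]
      constructor
      · intro h1
        have h2 : X ^ (m - e) ∣ p := by
          rw [← mul_dvd_mul_iff_left (hX e), ← pow_add, Nat.add_sub_cancel' h]
          exact h1
        obtain ⟨q, rfl⟩ := h2
        exact ⟨truncMk e q, rfl⟩
      · rintro ⟨z, hz⟩
        obtain ⟨q, rfl⟩ := Ideal.Quotient.mk_surjective z
        have h1 : truncMk m (X ^ (m - e) * q) = truncMk m p := hz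
        rw [← sub_eq_zero, ← map_sub, truncMk_eq_zero_iff] at h1
        have h2 : X ^ m ∣ X ^ e * (X ^ (m - e) * q) := by
          rw [← mul_assoc, ← pow_add, Nat.add_sub_cancel' h]; exact dvd_mul_right _ _
        have h3 := dvd_sub h2 (h1.mul_left (X ^ e))
        convert h3 using 1
        ring
    rw [hrange, LinearMap.finrank_range_of_inj hinj, finrank_truncPoly]

theorem finrank_ker_mul_X_pow_mul_unit (m e : ℕ) {u : TruncPoly m} (hu : IsUnit u) :
    Module.finrank ℂ (LinearMap.ker (LinearMap.mulLeft ℂ (truncMk m (X ^ e) * u))) = min m e := by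
  have : LinearMap.ker (LinearMap.mulLeft ℂ (truncMk m (X ^ e) * u)) =
      LinearMap.ker (LinearMap.mulLeft ℂ (truncMk m (X ^ e))) := by
    ext y
    rw [LinearMap.mem_ker, LinearMap.mem_ker, LinearMap.mulLeft_apply, LinearMap.mulLeft_apply,
      mul_right_comm, hu.mul_left_eq_zero]
  rw [this, finrank_ker_mul_X_pow]

theorem finrank_ker_mul_zero (m : ℕ) :
    Module.finrank ℂ (LinearMap.ker (LinearMap.mulLeft ℂ (0 : TruncPoly m))) = m := by
  rw [LinearMap.mulLeft_zero_eq_zero, LinearMap.ker_zero, finrank_top, finrank_truncPoly]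

/-- The dimension of a space of vectors with componentwise annihilators. -/
theorem finrank_eq_sum_ker {R ι E : Type*} [CommRing R] [Algebra ℂ R] [Module.Finite ℂ R]
    [Fintype ι] [AddCommGroup E] [Module ℂ E] (c : ι → R) (f : E →ₗ[ℂ] (ι → R))
    (hf : Function.Injective f) (hr : ∀ y, y ∈ LinearMap.range f ↔ ∀ i, c i * y i = 0) :
    Module.finrank ℂ E = ∑ i, Module.finrank ℂ (LinearMap.ker (LinearMap.mulLeft ℂ (c i))) := by
  let g : (∀ i, LinearMap.ker (LinearMap.mulLeft ℂ (c i))) →ₗ[ℂ] (ι → R) :=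
    LinearMap.pi fun i => (Submodule.subtype _) ∘ₗ LinearMap.proj i
  have hg : Function.Injective g := by
    intro a b hab
    funext i
    exact Subtype.ext (congrFun hab i)
  have : LinearMap.range f = LinearMap.range g := by
    ext y
    rw [hr]
    constructor
    · exact fun h => ⟨fun i => ⟨y i, by simpa using h i⟩, rfl⟩
    · rintro ⟨z, rfl⟩ i
      exact (z i).2
  rw [← LinearMap.finrank_range_of_inj hf, this, LinearMap.finrank_range_of_inj hg,
    Module.finrank_pi_fintype]

section Hom

variable {Λ R : Type*} [CommRing Λ] [CommRing R] [Algebra ℂ R] (φ : Λ →+* R)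

/-- The space of semilinear maps to `R` depends only on the isomorphism class. -/
theorem finrank_hom_congr {M N : Type*} [AddCommGroup M] [AddCommGroup N] [Module Λ M] [Module Λ N]
    (e : M ≃ₗ[Λ] N) :
    Module.finrank ℂ (M →ₛₗ[φ] R) = Module.finrank ℂ (N →ₛₗ[φ] R) :=
  LinearEquiv.finrank_eq
    { toFun := fun f => f.comp (e.symm : N →ₗ[Λ] M)
      invFun := fun f => f.comp (e : M →ₗ[Λ] N)
      map_add' := fun f g => by ext; simp
      map_smul' := fun a f => by ext; simp
      left_inv := fun f => by ext; simp
      right_inv := fun f => by ext; simp }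

variable [Module.Finite ℂ R]

/-- A semilinear map on the cokernel is a row vector `y` with `y A = 0` over `R`. Replacing `y` by
`y Q⁻¹` turns this into `y * diagonal c = 0`, which decouples into one annihilator condition per
coordinate. -/
theorem finrank_hom_coker {n : ℕ} (A : Matrix (Fin n) (Fin n) Λ)
    (Q P : Matrix (Fin n) (Fin n) R) (hQ : IsUnit Q.det) (hP : IsUnit P.det) (c : Fin n → R)
    (hQAP : Q * A.map φ * P = diagonal c) :
    Module.finrank ℂ (((Fin n → Λ) ⧸ LinearMap.range A.mulVecLin) →ₛₗ[φ] R) =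
      ∑ i, Module.finrank ℂ (LinearMap.ker (LinearMap.mulLeft ℂ (c i))) := by
  let f₀ : (((Fin n → Λ) ⧸ LinearMap.range A.mulVecLin) →ₛₗ[φ] R) →ₗ[ℂ] (Fin n → R) :=
    { toFun := fun f i => f (Submodule.Quotient.mk (Pi.single i 1))
      map_add' := fun f g => rfl
      map_smul' := fun a f => rfl }
  let f : (((Fin n → Λ) ⧸ LinearMap.range A.mulVecLin) →ₛₗ[φ] R) →ₗ[ℂ] (Fin n → R) :=
    (Q⁻¹.vecMulLinear.restrictScalars ℂ) ∘ₗ f₀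
  have hexp : ∀ (f : ((Fin n → Λ) ⧸ LinearMap.range A.mulVecLin) →ₛₗ[φ] R) (v : Fin n → Λ),
      f (Submodule.Quotient.mk v) = ∑ i, φ (v i) * f₀ f i := by
    intro f v
    conv_lhs => rw [pi_eq_sum_univ' v]
    rw [← Submodule.mkQ_apply, map_sum, map_sum]
    refine Finset.sum_congr rfl fun i _ => ?_
    rw [map_smul, map_smulₛₗ, smul_eq_mul]
    congr 3
  have hrange₀ : ∀ y, y ∈ LinearMap.range f₀ ↔ y ᵥ* A.map φ = 0 := by
    intro y
    constructor
    · rintro ⟨g, rfl⟩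
      funext j
      have h1 := hexp g (A *ᵥ Pi.single j 1)
      have h2 : (Submodule.Quotient.mk (A *ᵥ Pi.single j 1) :
          (Fin n → Λ) ⧸ LinearMap.range A.mulVecLin) = 0 :=
        (Submodule.Quotient.mk_eq_zero _).2 ⟨Pi.single j 1, rfl⟩
      rw [h2, map_zero] at h1
      rw [Pi.zero_apply, h1, vecMul, dotProduct]
      refine Finset.sum_congr rfl fun i _ => ?_
      rw [mulVec_single_one, mul_comm]
      rfl
    · intro hy
      let g₀ : (Fin n → Λ) →ₛₗ[φ] R :=
        { toFun := fun v => ∑ i, φ (v i) * y i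
          map_add' := fun v w => by simp [add_mul, Finset.sum_add_distrib]
          map_smul' := fun a v => by simp [Finset.mul_sum, mul_assoc] }
      refine ⟨Submodule.liftQ _ g₀ ?_, ?_⟩
      · rintro _ ⟨v, rfl⟩
        rw [LinearMap.mem_ker]
        change ∑ i, φ ((A *ᵥ v) i) * y i = 0
        have : ∑ i, φ ((A *ᵥ v) i) * y i = (y ᵥ* A.map φ) ⬝ᵥ fun i => φ (v i) := by
          rw [← dotProduct_mulVec, dotProduct]
          refine Finset.sum_congr rfl fun i _ => ?_
          rw [mul_comm]
          congr 1
          simp [mulVec, dotProduct]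
        rw [this, hy, zero_dotProduct]
      · funext i
        change ∑ j, φ ((Pi.single i 1 : Fin n → Λ) j) * y j = y i
        rw [Finset.sum_eq_single i]
        · simp
        · intro j _ hj; simp [hj]
        · simp
  refine finrank_eq_sum_ker c f ?_ ?_
  · intro g g' h
    have h1 : f₀ g = f₀ g' := by
      have h2 : f₀ g ᵥ* Q⁻¹ = f₀ g' ᵥ* Q⁻¹ := h
      have h3 := congrArg (fun w => w ᵥ* Q) h2
      simpa [vecMul_vecMul, Matrix.nonsing_inv_mul _ hQ] using h3
    refine LinearMap.ext fun v => ?_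
    obtain ⟨v, rfl⟩ := Submodule.Quotient.mk_surjective _ v
    rw [hexp, hexp, h1]
  · intro y
    have h1 : y ∈ LinearMap.range f ↔ (y ᵥ* Q) ∈ LinearMap.range f₀ := by
      constructor
      · rintro ⟨g, rfl⟩
        refine ⟨g, ?_⟩
        change f₀ g = (f₀ g ᵥ* Q⁻¹) ᵥ* Q
        simp [vecMul_vecMul, Matrix.nonsing_inv_mul _ hQ]
      · rintro ⟨g, hg⟩
        refine ⟨g, ?_⟩
        change f₀ g ᵥ* Q⁻¹ = y
        simp [hg, vecMul_vecMul, Matrix.mul_nonsing_inv _ hQ]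
    rw [h1, hrange₀, vecMul_vecMul]
    have h2 : y ᵥ* (Q * A.map φ) = 0 ↔ y ᵥ* diagonal c = 0 := by
      rw [← hQAP, ← vecMul_vecMul _ _ P]
      constructor
      · intro h; rw [h, zero_vecMul]
      · intro h
        have h3 := congrArg (fun w => w ᵥ* P⁻¹) h
        simpa [vecMul_vecMul, Matrix.mul_nonsing_inv_cancel_right _ _ hP] using h3
    rw [h2, funext_iff]
    refine forall_congr' fun i => ?_
    rw [vecMul_diagonal, Pi.zero_apply, mul_comm]

/-- A map is determined by the images of the generators: that of the `i`-th cyclic one is any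
element killed by `φ (d i)`, and those of the free ones are arbitrary, that is, killed by `0`. -/
theorem finrank_hom_invariantFactors {k r : ℕ} (d : Fin k → Λ) :
    Module.finrank ℂ ((((i : Fin k) → Λ ⧸ Ideal.span {d i}) × (Fin r → Λ)) →ₛₗ[φ] R) =
      ∑ i, Module.finrank ℂ (LinearMap.ker (LinearMap.mulLeft ℂ (φ (d i)))) +
        r * Module.finrank ℂ (LinearMap.ker (LinearMap.mulLeft ℂ (0 : R))) := by
  let f : ((((i : Fin k) → Λ ⧸ Ideal.span {d i}) × (Fin r → Λ)) →ₛₗ[φ] R) →ₗ[ℂ]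
      (Fin k ⊕ Fin r → R) :=
    { toFun := fun g => Sum.elim (fun i => g (Pi.single i 1, 0)) (fun j => g (0, Pi.single j 1))
      map_add' := fun g g' => by funext x; cases x <;> rfl
      map_smul' := fun a g => by funext x; cases x <;> rfl }
  have hf1 : ∀ g i, f g (Sum.inl i) = g (Pi.single i 1, 0) := fun g i => rfl
  have hf2 : ∀ g j, f g (Sum.inr j) = g (0, Pi.single j 1) := fun g i => rfl
  rw [finrank_eq_sum_ker (Sum.elim (fun i => φ (d i)) fun _ => 0) f ?_ ?_]
  · rw [Fintype.sum_sum_type]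
    congr 1
    refine (Finset.sum_congr rfl fun _ _ => (rfl : _ = Module.finrank ℂ
      (LinearMap.ker (LinearMap.mulLeft ℂ (0 : R))))).trans ?_
    rw [Finset.sum_const, Finset.card_univ, Fintype.card_fin, smul_eq_mul]
  · rw [← LinearMap.ker_eq_bot, LinearMap.ker_eq_bot']
    intro g hg
    have h1 : ∀ i (a : Λ ⧸ Ideal.span {d i}), g (Pi.single i a, 0) = 0 := by
      intro i a
      obtain ⟨a, rfl⟩ := Ideal.Quotient.mk_surjective a
      have : (Pi.single i (Ideal.Quotient.mk _ a), 0) =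
          a • ((Pi.single i 1, 0) : ((i : Fin k) → Λ ⧸ Ideal.span {d i}) × (Fin r → Λ)) := by
        rw [Prod.smul_mk, smul_zero, ← Pi.single_smul]
        congr 2
        rw [← map_one (Ideal.Quotient.mk _)]
        change _ = Ideal.Quotient.mk _ (a * 1)
        rw [mul_one]
      rw [this, map_smulₛₗ, ← hf1, hg, Pi.zero_apply, smul_zero]
    have h2 : ∀ j (a : Λ), g (0, Pi.single j a) = 0 := by
      intro j a
      have : (0, Pi.single j a) =
          a • ((0, Pi.single j 1) : ((i : Fin k) → Λ ⧸ Ideal.span {d i}) × (Fin r → Λ)) := by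
        rw [Prod.smul_mk, smul_zero, ← Pi.single_smul, smul_eq_mul, mul_one]
      rw [this, map_smulₛₗ, ← hf2, hg, Pi.zero_apply, smul_zero]
    ext ⟨v, w⟩
    have h3 : (v, w) = ∑ i, ((Pi.single i (v i), 0) :
        ((i : Fin k) → Λ ⧸ Ideal.span {d i}) × (Fin r → Λ)) + ∑ j, (0, Pi.single j (w j)) := by
      ext1
      · simp [Prod.fst_sum, Finset.univ_sum_single]
      · simp [Prod.snd_sum, Finset.univ_sum_single]
    rw [h3, map_add, map_sum, map_sum]
    simp [h1, h2]
  · intro y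
    constructor
    · rintro ⟨g, rfl⟩ (i | j)
      · rw [Sum.elim_inl, hf1, ← smul_eq_mul, ← map_smulₛₗ, Prod.smul_mk, smul_zero,
          ← Pi.single_smul]
        have : d i • (1 : Λ ⧸ Ideal.span {d i}) = 0 := by
          rw [← map_one (Ideal.Quotient.mk _)]
          change Ideal.Quotient.mk _ (d i * 1) = 0
          rw [mul_one]
          exact Ideal.Quotient.eq_zero_iff_mem.2 (Ideal.mem_span_singleton_self _)
        rw [this, Pi.single_zero]
        exact map_zero g
      · simp
    · intro hy
      let s : R → (Λ →ₛₗ[φ] R) := fun z =>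
        { toFun := fun a => φ a * z
          map_add' := fun a b => by simp [add_mul]
          map_smul' := fun a b => by simp [mul_assoc] }
      let t : ∀ i, (Λ ⧸ Ideal.span {d i}) →ₛₗ[φ] R := fun i =>
        Submodule.liftQ (Ideal.span {d i}) (s (y (Sum.inl i))) (by
          intro a ha
          obtain ⟨b, rfl⟩ := Ideal.mem_span_singleton.1 ha
          have := hy (Sum.inl i)
          rw [Sum.elim_inl] at this
          change φ (d i * b) * y (Sum.inl i) = 0
          rw [map_mul, mul_right_comm, this, zero_mul])
      have ht : ∀ i, t i 1 = y (Sum.inl i) := fun i => by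
        change φ 1 * y (Sum.inl i) = _
        rw [map_one, one_mul]
      let g : (((i : Fin k) → Λ ⧸ Ideal.span {d i}) × (Fin r → Λ)) →ₛₗ[φ] R :=
        { toFun := fun v => ∑ i, t i (v.1 i) + ∑ j, s (y (Sum.inr j)) (v.2 j)
          map_add' := fun v w => by
            simp only [Prod.fst_add, Prod.snd_add, Pi.add_apply, map_add, Finset.sum_add_distrib]
            ring
          map_smul' := fun a v => by
            simp only [Prod.smul_fst, Prod.smul_snd, Pi.smul_apply, map_smulₛₗ, smul_add,
              Finset.smul_sum] }
      refine ⟨g, ?_⟩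
      funext x
      rcases x with i | j
      · rw [hf1]
        change ∑ i', t i' ((Pi.single i 1 : (i : Fin k) → Λ ⧸ Ideal.span {d i}) i') +
          ∑ j, s (y (Sum.inr j)) 0 = _
        rw [Finset.sum_eq_single i]
        · simp [ht]
        · intro i' _ hi'; simp [Pi.single_eq_of_ne hi']
        · simp
      · rw [hf2]
        change ∑ i', t i' 0 + ∑ j', φ ((Pi.single j 1 : Fin r → Λ) j') * y (Sum.inr j') = _
        rw [Finset.sum_eq_single j]
        · simp
        · intro i' _ hi'; simp [Pi.single_eq_of_ne hi']
        · simp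

end Hom

end LinkSignature

/-! ### Orders of the diagonal entries as exponents of `f_ρ` -/

namespace LinkSignature

open Matrix Polynomial

theorem eval_star_cayleyDen : (star cayleyDen).eval 0 = 1 := by simp [star_cayleyDen]

theorem eval_star_cayleyNum (ρ : Circle) : (star (cayleyNum ρ)).eval 0 = (ρ : ℂ)⁻¹ := by
  simp [star_cayleyNum]

/-- The value of `t = ρ⁻¹ (1 - i x) / (1 + i x)` in `ℂ[X] / (X ^ m)`. -/
noncomputable def cayleyUnit (ρ : Circle) (m : ℕ) : (TruncPoly m)ˣ :=
  (isUnit_truncMk m (p := star (cayleyNum ρ)) (by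
      rw [eval_star_cayleyNum]; exact inv_ne_zero (Circle.coe_ne_zero ρ))).unit *
    (isUnit_truncMk m (p := star cayleyDen) (by
      rw [eval_star_cayleyDen]; exact one_ne_zero)).unit⁻¹

theorem cayleyUnit_mul (ρ : Circle) (m : ℕ) :
    (cayleyUnit ρ m : TruncPoly m) * truncMk m (star cayleyDen) =
      truncMk m (star (cayleyNum ρ)) := by
  rw [cayleyUnit, Units.val_mul, mul_assoc, IsUnit.val_inv_mul, mul_one, IsUnit.unit_spec]

/-- Evaluation of real Laurent polynomials at `t = ρ⁻¹ (1 - i x) / (1 + i x)` modulo `x ^ m`. -/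
noncomputable def cayleyHom (ρ : Circle) (m : ℕ) : ℝ[T;T⁻¹] →+* TruncPoly m :=
  LaurentPolynomial.eval₂ ((truncMk m).comp (C.comp Complex.ofRealHom)) (cayleyUnit ρ m)

theorem cayleyHom_T (ρ : Circle) (m : ℕ) :
    cayleyHom ρ m (LaurentPolynomial.T 1) = cayleyUnit ρ m := by
  rw [cayleyHom, LaurentPolynomial.eval₂_T, zpow_one]

theorem cayleyHom_T_neg (ρ : Circle) (m : ℕ) :
    cayleyHom ρ m (LaurentPolynomial.T (-1)) = (cayleyUnit ρ m)⁻¹ := by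
  rw [cayleyHom, LaurentPolynomial.eval₂_T, _root_.zpow_neg_one]

theorem cayleyHom_C (ρ : Circle) (m : ℕ) (r : ℝ) :
    cayleyHom ρ m (LaurentPolynomial.C r) = truncMk m (C (r : ℂ)) := by
  rw [cayleyHom, LaurentPolynomial.eval₂_C]; rfl

/-- This is `W(z) = (1 - z) (V - t Vᵀ)` at `t = z⁻¹`, with denominators cleared. -/
theorem cayleyW_map {n : ℕ} (V : Matrix (Fin n) (Fin n) ℤ) (ρ : Circle) (m : ℕ) :
    (cayleyW V ρ).map (truncMk m) =
      truncMk m ((cayleyDen - cayleyNum ρ) * star cayleyDen) •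
        (presMatrix V).map (cayleyHom ρ m) := by
  ext i j
  simp only [cayleyW, presMatrix, Matrix.map_apply, Matrix.smul_apply, Matrix.sub_apply,
    transpose_apply, smul_eq_mul, map_mul, map_sub, map_intCast, cayleyHom_T, ← cayleyUnit_mul]
  ring

/-- At `x = 0` the parameter `t` equals `ρ⁻¹`, so the image has constant term `q (ρ⁻¹)`, and a
nonzero constant term means a unit. -/
theorem isUnit_cayleyHom {ρ : Circle} (m : ℕ) {q : ℝ[X]} (hq : aeval ((ρ : ℂ)⁻¹) q ≠ 0) :
    IsUnit (cayleyHom ρ m (toLaurent q)) := by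
  rcases Nat.eq_zero_or_pos m with rfl | hm
  · have : Subsingleton (TruncPoly 0) := by
      rw [Ideal.Quotient.subsingleton_iff, pow_zero, Ideal.span_singleton_one]
    exact isUnit_of_subsingleton _
  obtain ⟨s, hs⟩ := Ideal.Quotient.mk_surjective (cayleyUnit ρ m : TruncPoly m)
  have hs0 : s.eval 0 = (ρ : ℂ)⁻¹ := by
    have h1 := cayleyUnit_mul ρ m
    rw [← hs, ← map_mul, ← sub_eq_zero, ← map_sub, truncMk_eq_zero_iff] at h1
    have h2 := X_dvd_iff.1 ((dvd_pow_self X hm.ne').trans h1)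
    rw [coeff_zero_eq_eval_zero, eval_sub, eval_mul, eval_star_cayleyDen, eval_star_cayleyNum,
      mul_one, sub_eq_zero] at h2
    exact h2
  have h1 : cayleyHom ρ m (toLaurent q) = truncMk m ((q.map Complex.ofRealHom).comp s) := by
    rw [cayleyHom, LaurentPolynomial.eval₂_toLaurent, ← hs, Polynomial.comp, Polynomial.eval₂_map,
      Polynomial.hom_eval₂]
  rw [h1]
  refine isUnit_truncMk m ?_
  rw [eval_comp, hs0, eval_map]
  exact hq

theorem Circle.im_ne_zero {ρ : Circle} (h1 : ρ ≠ 1) (h2 : ρ ≠ -1) : (ρ : ℂ).im ≠ 0 := by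
  intro h
  have h3 : (ρ : ℂ).re ^ 2 + (ρ : ℂ).im ^ 2 = 1 := by
    have := Circle.normSq_coe ρ
    rw [Complex.normSq_apply] at this
    linarith
  rw [h] at h3
  rcases sq_eq_one_iff.1 (by linarith : (ρ : ℂ).re ^ 2 = 1) with h4 | h4
  · exact h1 (Circle.ext (Complex.ext (by simpa using h4) (by simpa using h)))
  · exact h2 (Circle.ext (Complex.ext (by simpa using h4) (by simpa using h)))

theorem primeAt_of_ne {ρ : Circle} (h1 : ρ ≠ 1) (h2 : ρ ≠ -1) :
    primeAt ρ = LaurentPolynomial.T 1 + LaurentPolynomial.T (-1) -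
      LaurentPolynomial.C (2 * (ρ : ℂ).re) := by
  rw [primeAt, if_neg h1, if_neg h2]

theorem Circle.neg_one_ne_one : (-1 : Circle) ≠ 1 := fun h => by
  have := congrArg (fun z : Circle => (z : ℂ).re) h
  norm_num at this

theorem primeAt_neg_one : primeAt (-1) = LaurentPolynomial.T 1 + 1 := by
  rw [primeAt, if_neg Circle.neg_one_ne_one, if_pos rfl]

theorem toLaurent_quadratic (c : ℝ) : toLaurent (X ^ 2 - C c * X + 1 : ℝ[X]) =
    LaurentPolynomial.T 1 * (LaurentPolynomial.T 1 + LaurentPolynomial.T (-1) -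
      LaurentPolynomial.C c) := by
  have h : (LaurentPolynomial.T 1 * LaurentPolynomial.T (-1) : ℝ[T;T⁻¹]) = 1 := by
    rw [← LaurentPolynomial.T_add]; simp
  have h2 : (LaurentPolynomial.T (2 : ℕ) : ℝ[T;T⁻¹]) =
      LaurentPolynomial.T 1 * LaurentPolynomial.T 1 := by
    rw [← LaurentPolynomial.T_add]; rfl
  rw [map_add, map_sub, map_mul, toLaurent_X_pow, toLaurent_C, toLaurent_X, map_one, h2, ← h]
  ring

/-- For nonreal `ρ`, a real polynomial vanishing at `ρ⁻¹` is divisible by the real quadratic with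
roots `ρ` and `ρ⁻¹`, which is `t f_ρ`; for `ρ = -1` the linear factor suffices. -/
theorem primeAt_dvd_toLaurent {ρ : Circle} (h1 : ρ ≠ 1) {q : ℝ[X]}
    (hq : aeval ((ρ : ℂ)⁻¹) q = 0) : primeAt ρ ∣ toLaurent q := by
  by_cases h2 : ρ = -1
  · subst h2
    rw [primeAt_neg_one]
    have h3 : X - C (-1) ∣ q := by
      rw [dvd_iff_isRoot, IsRoot]
      have h4 : ((-1 : Circle) : ℂ)⁻¹ = algebraMap ℝ ℂ (-1) := by simp
      rw [h4, aeval_algebraMap_apply] at hq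
      simpa using hq
    have h4 := map_dvd toLaurent h3
    simpa using h4
  · have him := Circle.im_ne_zero h1 h2
    rw [primeAt_of_ne h1 h2]
    rw [← Circle.coe_inv] at hq
    have h3 := Polynomial.quadratic_dvd_of_aeval_eq_zero_im_ne_zero q hq (by
      rw [Circle.coe_inv_eq_conj]; simpa using him)
    have h4 : (X ^ 2 - C (2 * ((ρ⁻¹ : Circle) : ℂ).re) * X +
        C (‖((ρ⁻¹ : Circle) : ℂ)‖ ^ 2) : ℝ[X]) =
        X ^ 2 - C (2 * (ρ : ℂ).re) * X + 1 := by
      rw [Circle.norm_coe, Circle.coe_inv_eq_conj]; simp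
    rw [h4] at h3
    have h5 := map_dvd toLaurent h3
    rw [toLaurent_quadratic] at h5
    exact (dvd_mul_left _ _).trans h5

theorem isUnit_cayleyHom_of_not_dvd {ρ : Circle} (h1 : ρ ≠ 1) (m : ℕ) {g : ℝ[T;T⁻¹]}
    (hg : ¬ primeAt ρ ∣ g) : IsUnit (cayleyHom ρ m g) := by
  obtain ⟨N, q, hq⟩ := LaurentPolynomial.exists_T_pow g
  have h2 : aeval ((ρ : ℂ)⁻¹) q ≠ 0 := by
    intro h
    apply hg
    have h3 := primeAt_dvd_toLaurent h1 h
    rw [hq] at h3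
    exact (LaurentPolynomial.isUnit_T (R := ℝ) N).dvd_mul_right.1 h3
  have h3 := isUnit_cayleyHom m h2
  rw [hq, map_mul] at h3
  exact isUnit_of_mul_isUnit_left h3

/-- The prime `f_ρ` is a uniformizer in the parameter `x`. -/
theorem cayleyHom_primeAt {ρ : Circle} (h1 : ρ ≠ 1) (m : ℕ) :
    ∃ u : TruncPoly m, IsUnit u ∧ cayleyHom ρ m (primeAt ρ) = truncMk m X * u := by
  have hB : IsUnit (truncMk m (star cayleyDen)) :=
    isUnit_truncMk m (by rw [eval_star_cayleyDen]; exact one_ne_zero)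
  have hA : IsUnit (truncMk m (star (cayleyNum ρ))) :=
    isUnit_truncMk m (by rw [eval_star_cayleyNum]; exact inv_ne_zero (Circle.coe_ne_zero ρ))
  suffices h : ∃ c w : ℂ[X], IsUnit (truncMk m c) ∧ w.eval 0 ≠ 0 ∧
      cayleyHom ρ m (primeAt ρ) * truncMk m c = truncMk m (X * w) by
    obtain ⟨c, w, hc, hw, he⟩ := h
    refine ⟨truncMk m w * ↑(hc.unit⁻¹), (isUnit_truncMk m hw).mul (Units.isUnit _), ?_⟩
    rw [← mul_assoc, ← map_mul, ← he, mul_assoc, IsUnit.mul_val_inv, mul_one]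
  by_cases h2 : ρ = -1
  · subst h2
    refine ⟨star cayleyDen, C (2 * Complex.I), hB, by simp, ?_⟩
    rw [primeAt_neg_one, map_add, map_one, cayleyHom_T, add_mul, cayleyUnit_mul, one_mul,
      ← map_add]
    congr 1
    rw [star_cayleyNum, star_cayleyDen]
    simp only [Circle.coe_neg, Circle.coe_one, inv_neg, inv_one, map_neg, map_one, map_mul,
      map_ofNat]
    ring
  · have hi := C_mul_C_inv ρ
    -- With `a, b` the conjugated numerator and denominator, so `t = a / b`, clearing denominators
    -- in `f_ρ` gives `(a - ρ⁻¹ b) (a - ρ b)`. The first factor is `-2 i ρ⁻¹ x`; the second is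
    -- nonzero at `0` since `ρ² ≠ 1`.
    refine ⟨star cayleyDen * star (cayleyNum ρ),
      C (2 * Complex.I * (1 - ((ρ : ℂ)⁻¹) ^ 2)) - C (2 * (1 + ((ρ : ℂ)⁻¹) ^ 2)) * X, ?_, ?_, ?_⟩
    · rw [map_mul]; exact hB.mul hA
    · have h3 : ((ρ : ℂ)⁻¹) ^ 2 ≠ 1 := by
        rw [inv_pow, Ne, inv_eq_one, sq_eq_one_iff]
        rintro (h | h)
        · exact h1 (Circle.ext (by simpa using h))
        · exact h2 (Circle.ext (by simpa using h))
      simpa [sub_eq_zero] using h3.symm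
    · have hτ : ((cayleyUnit ρ m)⁻¹ : (TruncPoly m)ˣ) * truncMk m (star (cayleyNum ρ)) =
          truncMk m (star cayleyDen) := by
        rw [← cayleyUnit_mul, Units.inv_mul_cancel_left]
      have hre : (C ((2 * (ρ : ℂ).re : ℝ) : ℂ) : ℂ[X]) = C (ρ : ℂ) + C ((ρ : ℂ)⁻¹) := by
        rw [← C_add, ← Circle.coe_inv, Circle.coe_inv_eq_conj, Complex.add_conj]
      rw [primeAt_of_ne h1 h2, map_sub, map_add, cayleyHom_T, cayleyHom_T_neg, cayleyHom_C, hre]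
      have e : ((cayleyUnit ρ m : TruncPoly m) + ((cayleyUnit ρ m)⁻¹ : (TruncPoly m)ˣ) -
          truncMk m (C (ρ : ℂ) + C ((ρ : ℂ)⁻¹))) *
            truncMk m (star cayleyDen * star (cayleyNum ρ)) =
          truncMk m (star (cayleyNum ρ) ^ 2 + star cayleyDen ^ 2 -
            (C (ρ : ℂ) + C ((ρ : ℂ)⁻¹)) * (star cayleyDen * star (cayleyNum ρ))) := by
        simp only [map_sub, map_add, map_mul, map_pow]
        linear_combination truncMk m (star (cayleyNum ρ)) * cayleyUnit_mul ρ m +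
          truncMk m (star cayleyDen) * hτ
      rw [e]
      congr 1
      rw [star_cayleyNum, star_cayleyDen]
      have hI : (C Complex.I * C Complex.I : ℂ[X]) = -1 := by
        rw [← C_mul, Complex.I_mul_I, C_neg, C_1]
      simp only [map_mul, map_sub, map_add, map_pow, map_one, map_ofNat]
      linear_combination (-(1 + C Complex.I * X) * (1 - C Complex.I * X)) * hi +
        (2 * X ^ 2 * (1 + C ((ρ : ℂ)⁻¹) ^ 2)) * hI

theorem not_isUnit_cayleyHom_primeAt {ρ : Circle} (h1 : ρ ≠ 1) :
    ¬ IsUnit (cayleyHom ρ 1 (primeAt ρ)) := by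
  intro h2
  obtain ⟨u, hu, he⟩ := cayleyHom_primeAt h1 1
  rw [he] at h2
  have h3 := isUnit_of_mul_isUnit_left h2
  have h4 : truncMk 1 X = 0 := truncMk_eq_zero_iff.2 (by simp)
  rw [h4, isUnit_zero_iff, ← map_zero (truncMk 1), ← map_one (truncMk 1), ← sub_eq_zero, ← map_sub,
    truncMk_eq_zero_iff, pow_one, X_dvd_iff] at h3
  simp at h3

theorem primeAt_not_isUnit {ρ : Circle} (h1 : ρ ≠ 1) : ¬ IsUnit (primeAt ρ) :=
  fun h => not_isUnit_cayleyHom_primeAt h1 (h.map _)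

theorem aeval_eq_zero_of_primeAt_dvd {ρ : Circle} (h1 : ρ ≠ 1) {q : ℝ[X]}
    (h : primeAt ρ ∣ toLaurent q) : aeval ((ρ : ℂ)⁻¹) q = 0 := by
  by_contra hq
  exact not_isUnit_cayleyHom_primeAt h1
    (isUnit_of_dvd_unit (map_dvd (cayleyHom ρ 1) h) (isUnit_cayleyHom 1 hq))

/-- Excludes the default value `1` that `multiplicity` takes when the exponent is not finite. -/
theorem finiteMultiplicity_primeAt {ρ : Circle} (h1 : ρ ≠ 1) {d : ℝ[T;T⁻¹]} (hd : d ≠ 0) :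
    FiniteMultiplicity (primeAt ρ) d := by
  have : IsNoetherianRing ℝ[T;T⁻¹] :=
    IsLocalization.isNoetherianRing (Submonoid.powers (X : ℝ[X])) _ inferInstance
  exact FiniteMultiplicity.of_not_isUnit (primeAt_not_isUnit h1) hd

theorem finrank_ker_cayleyHom {ρ : Circle} (h1 : ρ ≠ 1) (m : ℕ) {d : ℝ[T;T⁻¹]} (hd : d ≠ 0) :
    Module.finrank ℂ (LinearMap.ker (LinearMap.mulLeft ℂ (cayleyHom ρ m d))) =
      min m (multiplicity (primeAt ρ) d) := by
  obtain ⟨g, hg, hgd⟩ := (finiteMultiplicity_primeAt h1 hd).exists_eq_pow_mul_and_not_dvd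
  obtain ⟨u, hu, he⟩ := cayleyHom_primeAt h1 m
  have h2 : cayleyHom ρ m d = truncMk m (X ^ multiplicity (primeAt ρ) d) *
      (u ^ multiplicity (primeAt ρ) d * cayleyHom ρ m g) := by
    conv_lhs => rw [hg]
    rw [map_mul, map_pow, he, map_pow, mul_pow, mul_assoc]
  rw [h2, finrank_ker_mul_X_pow_mul_unit]
  exact (hu.pow _).mul (isUnit_cayleyHom_of_not_dvd h1 m hgd)

theorem finrank_ker_truncMk (m : ℕ) {h : ℂ[X]} (h0 : h ≠ 0) :
    Module.finrank ℂ (LinearMap.ker (LinearMap.mulLeft ℂ (truncMk m h))) =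
      min m h.natTrailingDegree := by
  obtain ⟨u, hu, hu0⟩ := exists_eq_X_pow_mul h
  have h2 : truncMk m h = truncMk m (X ^ h.natTrailingDegree) * truncMk m u := by
    conv_lhs => rw [hu]
    rw [map_mul]
  rw [h2, finrank_ker_mul_X_pow_mul_unit]
  exact isUnit_truncMk m (by rw [hu0]; exact trailingCoeff_eq_zero.not.2 h0)

theorem smul_mul_mul_eq {R ι : Type*} [CommRing R] [Fintype ι] (u : R) (Q A P : Matrix ι ι R) :
    u • Q * A * P = Q * (u • A) * P := by
  rw [Matrix.smul_mul, ← Matrix.mul_smul]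

theorem map_mul_mul_eq_diagonal {R S ι : Type*} [CommRing R] [CommRing S] [Fintype ι]
    [DecidableEq ι] (f : R →+* S) {Q A P : Matrix ι ι R} {h : ι → R} (hd : Q * A * P = diagonal h) :
    Q.map f * A.map f * P.map f = diagonal fun i => f (h i) := by
  rw [← Matrix.map_mul, ← Matrix.map_mul, hd, Matrix.diagonal_map (map_zero f)]

/-- Both sides are the complex dimension of the semilinear maps from `M` to `ℂ[X] / (X ^ m)` along
`cayleyHom ρ m`, computed once from the diagonalization and once from the invariant factors. -/
theorem sum_min_eq {n : ℕ} {V : Matrix (Fin n) (Fin n) ℤ} {ρ : Circle} (h1 : ρ ≠ 1)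
    {P : Matrix (Fin n) (Fin n) ℂ[X]} {h : Fin n → ℂ[X]} (hP : P.det.eval 0 ≠ 0)
    (hPh : Pᴴ * cayleyW V ρ * P = diagonal h) {k : ℕ} {d : Fin k → ℝ[T;T⁻¹]}
    (hd : IsInvariantFactors V d) (m : ℕ) :
    ∑ i, (if h i = 0 then m else min m (h i).natTrailingDegree) =
      ∑ i, min m (multiplicity (primeAt ρ) (d i)) + (n - k) * m := by
  -- The factor `1 - z` relating `W` to the presentation matrix is invertible near `ρ` because `ρ ≠
  -- 1`.
  have hu : IsUnit (truncMk m ((cayleyDen - cayleyNum ρ) * star cayleyDen)) := by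
    refine isUnit_truncMk m ?_
    rw [eval_mul, eval_star_cayleyDen]
    simpa [cayleyDen, cayleyNum, sub_eq_zero, Circle.ext_iff] using
      fun h => h1 (Circle.ext (by simpa using h.symm))
  have hdetP : IsUnit (P.map (truncMk m)).det := by
    have : (P.map (truncMk m)).det = truncMk m P.det := (RingHom.map_det _ _).symm
    rw [this]
    exact isUnit_truncMk m hP
  have hdetQ : IsUnit ((Pᴴ).map (truncMk m)).det := by
    have : ((Pᴴ).map (truncMk m)).det = truncMk m (star P.det) := by
      rw [← det_conjTranspose]; exact (RingHom.map_det _ _).symm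
    rw [this]
    refine isUnit_truncMk m ?_
    have := eval_star P.det 0
    rw [Complex.ofReal_zero] at this
    rw [this]
    exact star_ne_zero.2 hP
  have hcoker := finrank_hom_coker (cayleyHom ρ m) (presMatrix V)
    (truncMk m ((cayleyDen - cayleyNum ρ) * star cayleyDen) • (Pᴴ).map (truncMk m))
    (P.map (truncMk m)) (by rw [det_smul]; exact (hu.pow _).mul hdetQ) hdetP
    (fun i => truncMk m (h i)) (by
      rw [smul_mul_mul_eq, ← cayleyW_map]
      exact map_mul_mul_eq_diagonal (truncMk m) hPh)
  have hiso := finrank_hom_congr (cayleyHom ρ m) hd.iso.some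
  rw [hcoker, finrank_hom_invariantFactors, finrank_ker_mul_zero] at hiso
  convert hiso using 2
  · split_ifs with h0
    · rw [h0, map_zero, finrank_ker_mul_zero]
    · rw [finrank_ker_truncMk m h0]
  · exact Finset.sum_congr rfl fun i _ => (finrank_ker_cayleyHom h1 m (hd.ne_zero i)).symm

/-- The orders of the diagonal entries are the exponents of `f_ρ` in the invariant factors. -/
theorem card_natTrailingDegree_eq {n : ℕ} {V : Matrix (Fin n) (Fin n) ℤ} {ρ : Circle} (h1 : ρ ≠ 1)
    {P : Matrix (Fin n) (Fin n) ℂ[X]} {h : Fin n → ℂ[X]} (hP : P.det.eval 0 ≠ 0)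
    (hPh : Pᴴ * cayleyW V ρ * P = diagonal h) {k : ℕ} {d : Fin k → ℝ[T;T⁻¹]}
    (hd : IsInvariantFactors V d) {m : ℕ} (hm : 0 < m) :
    (Finset.univ.filter fun i => h i ≠ 0 ∧ (h i).natTrailingDegree = m).card =
      (Finset.univ.filter fun i => multiplicity (primeAt ρ) (d i) = m).card := by
  obtain ⟨m, rfl⟩ : ∃ r, m = r + 1 := ⟨m - 1, by omega⟩
  have key := sum_min_eq h1 hP hPh hd
  -- The negated second difference of `m ↦ min m e` is the indicator of `e = m + 1`. Zero entries
  -- and free summands contribute terms linear in `m`, which it annihilates.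
  have e1 : ∀ i, ((if h i ≠ 0 ∧ (h i).natTrailingDegree = m + 1 then 1 else 0 : ℕ) : ℤ) =
      2 * ((if h i = 0 then m + 1 else min (m + 1) (h i).natTrailingDegree : ℕ) : ℤ) -
      ((if h i = 0 then m else min m (h i).natTrailingDegree : ℕ) : ℤ) -
      ((if h i = 0 then m + 2 else min (m + 2) (h i).natTrailingDegree : ℕ) : ℤ) := by
    intro i
    by_cases h0 : h i = 0
    · simp [h0]; ring
    · simp only [h0, if_false, ne_eq, not_false_eq_true, true_and]
      split_ifs <;> omega
  have e2 : ∀ i, ((if multiplicity (primeAt ρ) (d i) = m + 1 then 1 else 0 : ℕ) : ℤ) =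
      2 * ((min (m + 1) (multiplicity (primeAt ρ) (d i)) : ℕ) : ℤ) -
      ((min m (multiplicity (primeAt ρ) (d i)) : ℕ) : ℤ) -
      ((min (m + 2) (multiplicity (primeAt ρ) (d i)) : ℕ) : ℤ) := by
    intro i
    split_ifs <;> omega
  apply Nat.cast_injective (R := ℤ)
  rw [Finset.card_filter, Finset.card_filter]
  have k0 := congrArg (Nat.cast : ℕ → ℤ) (key m)
  have k1 := congrArg (Nat.cast : ℕ → ℤ) (key (m + 1))
  have k2 := congrArg (Nat.cast : ℕ → ℤ) (key (m + 2))
  rw [Nat.cast_add, Nat.cast_sum, Nat.cast_sum, Nat.cast_mul] at k0 k1 k2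
  rw [Nat.cast_sum, Nat.cast_sum, Finset.sum_congr rfl fun i _ => e1 i,
    Finset.sum_congr rfl fun i _ => e2 i]
  simp only [Finset.sum_sub_distrib, ← Finset.mul_sum]
  rw [k0, k1, k2]
  push_cast
  ring

end LinkSignature

/-! ### Jumps in terms of orders and signs -/

namespace LinkSignature

open Matrix Polynomial

/-- Local form of the signature function: `e` are the orders and `ε` the signs of the diagonal
entries of a diagonalization of `W` near `ρ`. -/
structure IsLocalForm {n : ℕ} (V : Matrix (Fin n) (Fin n) ℤ) (ρ : Circle) (e : Fin n → ℕ)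
    (ε : Fin n → ℤ) : Prop where
  abs_eq_one : ∀ i, ε i ≠ 0 → |ε i| = 1
  sig_eq : ∀ᶠ θ : ℝ in 𝓝 0, sig V (ρ * Circle.exp θ) = ∑ i, (SignType.sign θ : ℤ) ^ e i * ε i
  card_eq : ρ ≠ 1 → ∀ {k : ℕ} {d : Fin k → ℝ[T;T⁻¹]}, IsInvariantFactors V d → ∀ m, 0 < m →
    (Finset.univ.filter fun i => ε i ≠ 0 ∧ e i = m).card =
      (Finset.univ.filter fun i => multiplicity (primeAt ρ) (d i) = m).card

theorem exists_isLocalForm {n : ℕ} (V : Matrix (Fin n) (Fin n) ℤ) (ρ : Circle) :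
    ∃ e ε, IsLocalForm V ρ e ε := by
  obtain ⟨P, h, hP, hPh, hh⟩ := exists_diagonalize (cayleyW_isHermitian V ρ)
  have h0 : ∀ i, lowSign (h i) ≠ 0 ↔ h i ≠ 0 := fun i => by
    refine ⟨fun hl hz => hl (by rw [hz, lowSign_zero]), fun hz hl => ?_⟩
    have := abs_lowSign (hh i) hz
    rw [hl] at this
    simp at this
  refine ⟨fun i => (h i).natTrailingDegree, fun i => lowSign (h i), ⟨fun i hi =>
    abs_lowSign (hh i) ((h0 i).1 hi), eventually_sig_eq V ρ hP hPh hh, ?_⟩⟩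
  intro h1 k d hd m hm
  simp only [h0]
  exact card_natTrailingDegree_eq h1 hP hPh hd hm

namespace IsLocalForm

variable {n : ℕ} {V : Matrix (Fin n) (Fin n) ℤ} {ρ : Circle} {e : Fin n → ℕ} {ε : Fin n → ℤ}

theorem eventually_right (H : IsLocalForm V ρ e ε) :
    ∀ᶠ θ : ℝ in 𝓝[>] 0, sig V (ρ * Circle.exp θ) = ∑ i, ε i := by
  filter_upwards [H.sig_eq.filter_mono nhdsWithin_le_nhds, self_mem_nhdsWithin] with θ h hθ
  rw [h, sign_pos hθ]
  simp

theorem eventually_left (H : IsLocalForm V ρ e ε) :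
    ∀ᶠ θ : ℝ in 𝓝[<] 0, sig V (ρ * Circle.exp θ) = ∑ i, (-1) ^ e i * ε i := by
  filter_upwards [H.sig_eq.filter_mono nhdsWithin_le_nhds, self_mem_nhdsWithin] with θ h hθ
  rw [h, sign_neg hθ]
  simp

theorem sig_self (H : IsLocalForm V ρ e ε) : sig V ρ = ∑ i, 0 ^ e i * ε i := by
  have := H.sig_eq.self_of_nhds
  simpa using this

theorem tendsto_right (H : IsLocalForm V ρ e ε) :
    Filter.Tendsto (fun θ : ℝ => sig V (ρ * Circle.exp θ)) (𝓝[>] 0) (𝓝 (∑ i, ε i)) :=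
  tendsto_const_nhds.congr' (H.eventually_right.mono fun _ h => h.symm)

theorem tendsto_left (H : IsLocalForm V ρ e ε) :
    Filter.Tendsto (fun θ : ℝ => sig V (ρ * Circle.exp θ)) (𝓝[<] 0)
      (𝓝 (∑ i, (-1) ^ e i * ε i)) :=
  tendsto_const_nhds.congr' (H.eventually_left.mono fun _ h => h.symm)

theorem sigPlus_eq (H : IsLocalForm V ρ e ε) : sigPlus V ρ = ∑ i, ε i :=
  H.tendsto_right.limUnder_eq

theorem sigMinus_eq (H : IsLocalForm V ρ e ε) : sigMinus V ρ = ∑ i, (-1) ^ e i * ε i :=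
  H.tendsto_left.limUnder_eq

theorem card_filter_eq (H : IsLocalForm V ρ e ε) (h1 : ρ ≠ 1) {k : ℕ} {d : Fin k → ℝ[T;T⁻¹]}
    (hd : IsInvariantFactors V d) (p : ℕ → Prop) [DecidablePred p] :
    (Finset.univ.filter fun i => ε i ≠ 0 ∧ 0 < e i ∧ p (e i)).card =
      (Finset.univ.filter fun i => 0 < multiplicity (primeAt ρ) (d i) ∧
        p (multiplicity (primeAt ρ) (d i))).card := by
  -- A finite set containing all relevant exponents of both families; the fibres over each of its
  -- elements have equal size by `card_eq`.
  let t : Finset ℕ := (Finset.univ.image e ∪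
    Finset.univ.image fun i => multiplicity (primeAt ρ) (d i)).filter fun m => 0 < m ∧ p m
  rw [Finset.card_eq_sum_card_fiberwise (f := e) (t := t),
    Finset.card_eq_sum_card_fiberwise (f := fun i => multiplicity (primeAt ρ) (d i)) (t := t)]
  · refine Finset.sum_congr rfl fun m hm => ?_
    have hm' := (Finset.mem_filter.1 hm).2
    rw [Finset.filter_filter, Finset.filter_filter]
    convert H.card_eq h1 hd m hm'.1 using 2
    · ext i
      simp only [Finset.mem_filter, Finset.mem_univ, true_and]
      constructor
      · rintro ⟨⟨a, -⟩, rfl⟩; exact ⟨a, rfl⟩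
      · rintro ⟨a, rfl⟩; exact ⟨⟨a, hm'⟩, rfl⟩
    · ext i
      simp only [Finset.mem_filter, Finset.mem_univ, true_and]
      constructor
      · exact fun a => a.2
      · rintro rfl; exact ⟨hm', rfl⟩
  · intro i hi
    have := (Finset.mem_filter.1 hi).2
    refine Finset.mem_filter.2 ⟨Finset.mem_union_right _ ?_, this⟩
    exact Finset.mem_image_of_mem (fun i => multiplicity (primeAt ρ) (d i)) (Finset.mem_univ i)
  · intro i hi
    have := (Finset.mem_filter.1 hi).2
    refine Finset.mem_filter.2 ⟨Finset.mem_union_left _ ?_, this.2⟩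
    exact Finset.mem_image_of_mem _ (Finset.mem_univ _)

theorem card_odd_eq (H : IsLocalForm V ρ e ε) (h1 : ρ ≠ 1) {k : ℕ} {d : Fin k → ℝ[T;T⁻¹]}
    (hd : IsInvariantFactors V d) :
    (Finset.univ.filter fun i => ε i ≠ 0 ∧ 0 < e i ∧ Odd (e i)).card = phiOdd d ρ := by
  rw [H.card_filter_eq h1 hd, phiOdd]

theorem card_even_eq (H : IsLocalForm V ρ e ε) (h1 : ρ ≠ 1) {k : ℕ} {d : Fin k → ℝ[T;T⁻¹]}
    (hd : IsInvariantFactors V d) :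
    (Finset.univ.filter fun i => ε i ≠ 0 ∧ 0 < e i ∧ Even (e i)).card = phiEven d ρ := by
  rw [H.card_filter_eq h1 hd, phiEven]

/-- The value at `ρ` cancels, leaving `σ⁺ - σ⁻ = ∑ (1 - (-1) ^ e i) * ε i`: even orders drop out and
odd ones are doubled. -/
theorem jump_eq (H : IsLocalForm V ρ e ε) :
    jump V ρ = 2 * ∑ i with ε i ≠ 0 ∧ 0 < e i ∧ Odd (e i), ε i := by
  have : jump V ρ = sigPlus V ρ - sigMinus V ρ := by
    rw [jump, jumpPlus, jumpMinus]; ring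
  rw [this, H.sigPlus_eq, H.sigMinus_eq, ← Finset.sum_sub_distrib, Finset.mul_sum,
    Finset.sum_filter]
  refine Finset.sum_congr rfl fun i _ => ?_
  rcases Nat.even_or_odd (e i) with h | h
  · simp [h, Nat.not_odd_iff_even.2 h]
  · by_cases h0 : ε i = 0
    · simp [h0]
    · simp [h, h0, h.pos]; ring

end IsLocalForm

theorem abs_sum_sign {ι : Type*} (s : Finset ι) (ε : ι → ℤ) (h : ∀ i ∈ s, |ε i| = 1) :
    |∑ i ∈ s, ε i| ≤ s.card ∧ |∑ i ∈ s, ε i| ≡ s.card [ZMOD 2] := by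
  have hc : (s.card : ℤ) = ∑ i ∈ s, |ε i| := by
    rw [Finset.sum_congr rfl h]; simp
  have habs : ∀ x : ℤ, |x| ≡ x [ZMOD 2] := fun x => by
    rcases abs_choice x with h | h <;> rw [h]
    exact (Int.modEq_iff_dvd.2 ⟨x, by ring⟩)
  rw [hc]
  refine ⟨Finset.abs_sum_le_sum_abs _ _, (habs _).trans ?_⟩
  exact Int.ModEq.sum fun i _ => (habs _).symm

theorem jump_bound {n : ℕ} {V : Matrix (Fin n) (Fin n) ℤ} {ρ : Circle} (h1 : ρ ≠ 1) {k : ℕ}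
    {d : Fin k → ℝ[T;T⁻¹]} (hd : IsInvariantFactors V d) :
    |jump V ρ| ≤ 2 * (phiOdd d ρ : ℤ) ∧ |jump V ρ| ≡ 2 * (phiOdd d ρ : ℤ) [ZMOD 4] := by
  obtain ⟨e, ε, H⟩ := exists_isLocalForm V ρ
  have key := abs_sum_sign (Finset.univ.filter fun i => ε i ≠ 0 ∧ 0 < e i ∧ Odd (e i)) ε
    fun i hi => H.abs_eq_one i (Finset.mem_filter.1 hi).2.1
  rw [H.card_odd_eq h1 hd] at key
  rw [H.jump_eq, abs_mul, abs_two]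
  exact ⟨by linarith [key.1], key.2.mul_left' (c := 2)⟩

theorem W_inv {n : ℕ} (V : Matrix (Fin n) (Fin n) ℤ) (z : Circle) : W V z⁻¹ = (W V z)ᵀ := by
  ext i j
  simp [W]
  ring

/-- Inverting `z` transposes `W`, which preserves the characteristic polynomial and hence the
eigenvalues. -/
theorem sig_inv {n : ℕ} (V : Matrix (Fin n) (Fin n) ℤ) (z : Circle) : sig V z⁻¹ = sig V z := by
  have h : (W_isHermitian V z⁻¹).eigenvalues = (W_isHermitian V z).eigenvalues := by
    rw [Matrix.IsHermitian.eigenvalues_eq_eigenvalues_iff, W_inv, charpoly_transpose]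
  rw [sig, sig, signature, signature, h]

theorem IsLocalForm.jumps_neg_one {n : ℕ} {V : Matrix (Fin n) (Fin n) ℤ} {e : Fin n → ℕ}
    {ε : Fin n → ℤ} (H : IsLocalForm V (-1) e ε) :
    jumpPlus V (-1) = ∑ i with ε i ≠ 0 ∧ 0 < e i ∧ Even (e i), ε i ∧
      jumpMinus V (-1) = -∑ i with ε i ≠ 0 ∧ 0 < e i ∧ Even (e i), ε i := by
  -- Inversion fixes `-1` and exchanges its two sides, so the one-sided limits agree.
  have hsymm : ∑ i, ε i = ∑ i, (-1) ^ e i * ε i := by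
    have h1 := H.eventually_right
    have h2 : ∀ᶠ θ : ℝ in 𝓝[>] 0, sig V (-1 * Circle.exp (-θ)) = ∑ i, (-1) ^ e i * ε i := by
      have ht : Filter.Tendsto (fun θ : ℝ => -θ) (𝓝[>] 0) (𝓝[<] 0) := by
        refine tendsto_nhdsWithin_iff.2 ⟨?_, ?_⟩
        · have : Filter.Tendsto (fun θ : ℝ => -θ) (𝓝 0) (𝓝 0) := by
            simpa using (continuous_neg (G := ℝ)).tendsto 0
          exact this.mono_left nhdsWithin_le_nhds
        · filter_upwards [self_mem_nhdsWithin] with θ hθ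
          exact neg_lt_zero.2 (Set.mem_Ioi.1 hθ)
      exact ht.eventually H.eventually_left
    obtain ⟨θ, h3, h4⟩ := (h1.and h2).exists
    rw [← h3, ← h4, ← sig_inv]
    congr 1
    rw [mul_inv, Circle.exp_neg, inv_neg, inv_one]
  have hsum : jumpPlus V (-1) = ∑ i with ε i ≠ 0 ∧ 0 < e i ∧ Even (e i), ε i := by
    -- Averaging the two limits gives the weight `1 + (-1) ^ e - 2 * 0 ^ e`, which is `2` for
    -- positive even `e` and `0` otherwise.
    have h2 : 2 * jumpPlus V (-1) = 2 * ∑ i with ε i ≠ 0 ∧ 0 < e i ∧ Even (e i), ε i := by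
      have h3 : 2 * jumpPlus V (-1) =
          ∑ i, ε i + ∑ i, (-1) ^ e i * ε i - 2 * ∑ i, 0 ^ e i * ε i := by
        rw [← hsymm, jumpPlus, H.sigPlus_eq, H.sig_self]; ring
      rw [h3, Finset.mul_sum, Finset.mul_sum, ← Finset.sum_add_distrib, ← Finset.sum_sub_distrib,
        Finset.sum_filter]
      refine Finset.sum_congr rfl fun i _ => ?_
      by_cases h0 : ε i = 0
      · simp [h0]
      rcases Nat.even_or_odd (e i) with h | h
      · rcases Nat.eq_zero_or_pos (e i) with hz | hz
        · simp [hz]; ring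
        · simp [h, h0, hz, hz.ne']; ring
      · simp [h, h0, h.pos.ne']
    linarith
  refine ⟨hsum, ?_⟩
  rw [← hsum, jumpMinus, jumpPlus, H.sigMinus_eq, H.sigPlus_eq, hsymm]

theorem jumps_neg_one_bound {n : ℕ} {V : Matrix (Fin n) (Fin n) ℤ} {k : ℕ}
    {d : Fin k → ℝ[T;T⁻¹]} (hd : IsInvariantFactors V d) :
    (|jumpPlus V (-1)| ≤ (phiEven d (-1) : ℤ) ∧
      |jumpPlus V (-1)| ≡ (phiEven d (-1) : ℤ) [ZMOD 2]) ∧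
    (|jumpMinus V (-1)| ≤ (phiEven d (-1) : ℤ) ∧
      |jumpMinus V (-1)| ≡ (phiEven d (-1) : ℤ) [ZMOD 2]) := by
  obtain ⟨e, ε, H⟩ := exists_isLocalForm V (-1)
  have key := abs_sum_sign (Finset.univ.filter fun i => ε i ≠ 0 ∧ 0 < e i ∧ Even (e i)) ε
    fun i hi => H.abs_eq_one i (Finset.mem_filter.1 hi).2.1
  rw [H.card_even_eq Circle.neg_one_ne_one hd] at key
  rw [H.jumps_neg_one.1, H.jumps_neg_one.2, abs_neg]
  exact ⟨key, key⟩

theorem phiOdd_inv {k : ℕ} (d : Fin k → ℝ[T;T⁻¹]) {ρ : Circle} (h1 : ρ ≠ 1) (h2 : ρ ≠ -1) :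
    phiOdd d ρ⁻¹ = phiOdd d ρ := by
  have h3 : primeAt ρ⁻¹ = primeAt ρ := by
    rw [primeAt_of_ne h1 h2, primeAt_of_ne (inv_ne_one.2 h1) (by
      rw [Ne, inv_eq_iff_eq_inv, inv_neg, inv_one]; exact h2), Circle.coe_inv_eq_conj]
    simp
  rw [phiOdd, phiOdd, h3]

/-- If `f_ρ` divides some `d i` and `ρ ≠ 1`, then `ρ⁻¹` is a root of the nonzero polynomial obtained
from `d i` by multiplying with a power of `t`. The point `1` is added to the finite set without
further analysis. -/
theorem finite_phiOdd {k : ℕ} {d : Fin k → ℝ[T;T⁻¹]} (hd : ∀ i, d i ≠ 0) :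
    {ρ : Circle | phiOdd d ρ ≠ 0}.Finite := by
  choose N q hq using fun i => LaurentPolynomial.exists_T_pow (d i)
  have hq0 : ∀ i, q i ≠ 0 := fun i h => by
    have h1 := hq i
    rw [h, map_zero] at h1
    have h2 := (LaurentPolynomial.isUnit_T (R := ℝ) (N i)).mul_left_eq_zero.1 h1.symm
    exact hd i h2
  have hfin : ∀ i, {ρ : Circle | aeval ((ρ : ℂ)⁻¹) (q i) = 0}.Finite := fun i => by
    refine ((q i).rootSet_finite ℂ).preimage (f := fun ρ : Circle => (ρ : ℂ)⁻¹) ?_ |>.subset ?_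
    · intro a _ b _ hab
      exact Circle.ext (inv_injective hab)
    · intro ρ hρ
      exact (mem_rootSet_of_ne (hq0 i)).2 hρ
  refine ((Set.finite_singleton 1).union (Set.finite_iUnion hfin)).subset ?_
  intro ρ hρ
  by_cases h1 : ρ = 1
  · exact Or.inl h1
  right
  obtain ⟨i, hi⟩ := Finset.card_pos.1 (Nat.pos_of_ne_zero hρ)
  have hpos := (Finset.mem_filter.1 hi).2.1
  have hdvd : primeAt ρ ∣ d i := (dvd_pow_self _ hpos.ne').trans (pow_multiplicity_dvd _ _)
  refine Set.mem_iUnion.2 ⟨i, aeval_eq_zero_of_primeAt_dvd h1 ?_⟩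
  rw [hq i]
  exact hdvd.mul_right _

/-! ### Following the signature along the upper half circle -/

theorem sig_eventually_gt {n : ℕ} (V : Matrix (Fin n) (Fin n) ℤ) (x : ℝ) :
    ∀ᶠ y in 𝓝[>] x, sig V (Circle.exp y) = sigPlus V (Circle.exp x) := by
  obtain ⟨e, ε, H⟩ := exists_isLocalForm V (Circle.exp x)
  have ht : Filter.Tendsto (fun y : ℝ => y - x) (𝓝[>] x) (𝓝[>] 0) := by
    refine tendsto_nhdsWithin_iff.2 ⟨?_, ?_⟩
    · have : Filter.Tendsto (fun y : ℝ => y - x) (𝓝 x) (𝓝 0) := by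
        simpa using (continuous_sub_right x).tendsto x
      exact this.mono_left nhdsWithin_le_nhds
    · filter_upwards [self_mem_nhdsWithin] with y hy
      exact sub_pos.2 (Set.mem_Ioi.1 hy)
  filter_upwards [ht.eventually H.eventually_right] with y hy
  rw [H.sigPlus_eq, ← hy, ← Circle.exp_add, add_sub_cancel]

theorem sig_eventually_lt {n : ℕ} (V : Matrix (Fin n) (Fin n) ℤ) (x : ℝ) :
    ∀ᶠ y in 𝓝[<] x, sig V (Circle.exp y) = sigMinus V (Circle.exp x) := by
  obtain ⟨e, ε, H⟩ := exists_isLocalForm V (Circle.exp x)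
  have ht : Filter.Tendsto (fun y : ℝ => y - x) (𝓝[<] x) (𝓝[<] 0) := by
    refine tendsto_nhdsWithin_iff.2 ⟨?_, ?_⟩
    · have : Filter.Tendsto (fun y : ℝ => y - x) (𝓝 x) (𝓝 0) := by
        simpa using (continuous_sub_right x).tendsto x
      exact this.mono_left nhdsWithin_le_nhds
    · filter_upwards [self_mem_nhdsWithin] with y hy
      exact sub_neg.2 (Set.mem_Iio.1 hy)
  filter_upwards [ht.eventually H.eventually_left] with y hy
  rw [H.sigMinus_eq, ← hy, ← Circle.exp_add, add_sub_cancel]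

theorem sigPlus_eq_of_eventually {n : ℕ} {V : Matrix (Fin n) (Fin n) ℤ} {x : ℝ} {a : ℤ}
    (h : ∀ᶠ y in 𝓝[>] x, sig V (Circle.exp y) = a) : sigPlus V (Circle.exp x) = a := by
  obtain ⟨y, h1, h2⟩ := ((sig_eventually_gt V x).and h).exists
  rw [← h1, h2]

theorem sigPlus_eventually_gt {n : ℕ} (V : Matrix (Fin n) (Fin n) ℤ) (x : ℝ) :
    ∀ᶠ y in 𝓝[>] x, sigPlus V (Circle.exp y) = sigPlus V (Circle.exp x) := by
  filter_upwards [eventually_eventually_nhdsWithin.2 (sig_eventually_gt V x),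
    self_mem_nhdsWithin] with y hy hxy
  exact sigPlus_eq_of_eventually
    (hy.filter_mono (nhdsWithin_mono _ (Set.Ioi_subset_Ioi (le_of_lt hxy))))

theorem sigPlus_eventually_lt {n : ℕ} (V : Matrix (Fin n) (Fin n) ℤ) (x : ℝ) :
    ∀ᶠ y in 𝓝[<] x, sigPlus V (Circle.exp y) = sigMinus V (Circle.exp x) := by
  filter_upwards [eventually_eventually_nhdsWithin.2 (sig_eventually_lt V x),
    self_mem_nhdsWithin] with y hy hxy
  rw [isOpen_Iio.nhdsWithin_eq hxy] at hy
  exact sigPlus_eq_of_eventually (hy.filter_mono nhdsWithin_le_nhds)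

/-- The infimum of the failures would satisfy `P` by `left` (or `h0`), and `right` then pushes the
failures away from it. -/
theorem real_induction {P : ℝ → Prop} {a b : ℝ} (h0 : P a)
    (right : ∀ x ∈ Set.Ico a b, P x → ∀ᶠ y in 𝓝[>] x, P y)
    (left : ∀ x ∈ Set.Ioo a b, (∀ y ∈ Set.Ico a x, P y) → P x) :
    ∀ x ∈ Set.Ico a b, P x := by
  by_contra! h
  obtain ⟨x₀, hx₀, hPx₀⟩ := h
  let S : Set ℝ := {y | y ∈ Set.Ico a b ∧ ¬ P y}
  have hne : S.Nonempty := ⟨x₀, hx₀, hPx₀⟩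
  have hbdd : BddBelow S := ⟨a, fun y hy => hy.1.1⟩
  set t := sInf S with ht
  have hat : a ≤ t := le_csInf hne fun y hy => hy.1.1
  have htb : t < b := (csInf_le hbdd ⟨hx₀, hPx₀⟩).trans_lt hx₀.2
  have hlt : ∀ y ∈ Set.Ico a t, P y := fun y hy => by
    by_contra hP
    exact absurd (csInf_le hbdd (show y ∈ S from ⟨⟨hy.1, hy.2.trans htb⟩, hP⟩)) (not_le.2 hy.2)
  have hPt : P t := by
    rcases hat.eq_or_lt with h | h
    · rwa [← h]
    · exact left t ⟨h, htb⟩ hlt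
  obtain ⟨u, hu, hsub⟩ := mem_nhdsGT_iff_exists_Ioo_subset.1 (right t ⟨hat, htb⟩ hPt)
  have : u ≤ t := le_csInf hne fun y hy => by
    by_contra! hyu
    rcases (csInf_le hbdd hy).eq_or_lt with h | h
    · exact hy.2 (h ▸ hPt)
    · exact hy.2 (hsub ⟨h, hyu⟩)
  exact absurd this (not_le.2 hu)

theorem Circle.exp_ne_one {x : ℝ} (hx : x ∈ Set.Ioo 0 Real.pi) : Circle.exp x ≠ 1 := fun h => by
  have h1 := Circle.arg_exp (x := x) (by linarith [hx.1, hx.2]) hx.2.le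
  rw [h] at h1
  simp at h1
  exact hx.1.ne h1

theorem Circle.exp_ne_neg_one {x : ℝ} (hx : x ∈ Set.Ioo 0 Real.pi) : Circle.exp x ≠ -1 :=
  fun h => by
  have h1 := Circle.arg_exp (x := x) (by linarith [hx.1, hx.2]) hx.2.le
  rw [h] at h1
  simp at h1
  exact hx.2.ne h1.symm

theorem Circle.exp_im_pos {x : ℝ} (hx : x ∈ Set.Ioo 0 Real.pi) : 0 < (Circle.exp x : ℂ).im := by
  rw [Circle.coe_exp, Complex.exp_ofReal_mul_I_im]
  exact Real.sin_pos_of_mem_Ioo hx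

/-- The change of the signature function along the upper half circle. -/
theorem abs_sigPlus_sub_le {n : ℕ} {V : Matrix (Fin n) (Fin n) ℤ} {k : ℕ}
    {d : Fin k → ℝ[T;T⁻¹]} (hd : IsInvariantFactors V d) (U : Finset Circle)
    (hU : ∀ x ∈ Set.Ioo 0 Real.pi, phiOdd d (Circle.exp x) ≠ 0 → Circle.exp x ∈ U) :
    ∀ x ∈ Set.Ico 0 Real.pi, |sigPlus V (Circle.exp x) - sigPlus V 1| ≤
      ∑ ρ ∈ U.filter (fun ρ : Circle => (ρ : ℂ).arg ≤ x), 2 * (phiOdd d ρ : ℤ) := by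
  classical
  have hnn : ∀ ρ : Circle, (0 : ℤ) ≤ 2 * (phiOdd d ρ : ℤ) := fun ρ => by positivity
  have hmono : ∀ x y : ℝ, x ≤ y →
      ∑ ρ ∈ U.filter (fun ρ : Circle => (ρ : ℂ).arg ≤ x), 2 * (phiOdd d ρ : ℤ) ≤
      ∑ ρ ∈ U.filter (fun ρ : Circle => (ρ : ℂ).arg ≤ y), 2 * (phiOdd d ρ : ℤ) := fun x y hxy =>
    Finset.sum_le_sum_of_subset_of_nonneg
      (Finset.monotone_filter_right _ fun ρ _ h => le_trans h hxy) fun ρ _ _ => hnn ρ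
  -- `sigPlus` is constant just to the right of each point, so it changes only on reaching a point
  -- from the left, and then by exactly the total jump there.
  refine real_induction ?_ ?_ ?_
  · rw [Circle.exp_zero, sub_self, abs_zero]
    exact Finset.sum_nonneg fun ρ _ => hnn ρ
  · intro x _ hP
    filter_upwards [sigPlus_eventually_gt V x, self_mem_nhdsWithin] with y hy hxy
    rw [hy]
    exact hP.trans (hmono _ _ (le_of_lt hxy))
  · intro x hx hP
    have hIco : Set.Ico 0 x ∈ 𝓝[<] x := Ico_mem_nhdsLT hx.1
    obtain ⟨y, hy, hyx⟩ := ((sigPlus_eventually_lt V x).and hIco).exists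
    have h1 := hP y hyx
    rw [hy] at h1
    have hj := (jump_bound (V := V) (Circle.exp_ne_one hx) hd).1
    have hj' : jump V (Circle.exp x) =
        sigPlus V (Circle.exp x) - sigMinus V (Circle.exp x) := by
      rw [jump, jumpPlus, jumpMinus]; ring
    rw [hj'] at hj
    have harg := Circle.arg_exp (x := x) (by linarith [hx.1, Real.pi_pos]) hx.2.le
    -- The point `Circle.exp x` has argument `x > y`, so it is counted at `x` but not yet at `y`,
    -- which makes room for its jump.
    have hC : ∑ ρ ∈ U.filter (fun ρ : Circle => (ρ : ℂ).arg ≤ y), 2 * (phiOdd d ρ : ℤ) +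
        2 * (phiOdd d (Circle.exp x) : ℤ) ≤
          ∑ ρ ∈ U.filter (fun ρ : Circle => (ρ : ℂ).arg ≤ x), 2 * (phiOdd d ρ : ℤ) := by
      by_cases h0 : phiOdd d (Circle.exp x) = 0
      · rw [h0]
        simpa using hmono y x hyx.2.le
      · have hnot : Circle.exp x ∉ U.filter fun ρ : Circle => (ρ : ℂ).arg ≤ y := by
          rw [Finset.mem_filter, harg]
          exact fun h => absurd h.2 (not_le.2 hyx.2)
        rw [add_comm, ← Finset.sum_insert (f := fun ρ : Circle => 2 * (phiOdd d ρ : ℤ)) hnot]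
        refine Finset.sum_le_sum_of_subset_of_nonneg ?_ fun ρ _ _ => hnn ρ
        intro ρ hρ
        rcases Finset.mem_insert.1 hρ with rfl | hρ
        · exact Finset.mem_filter.2 ⟨hU x hx h0, harg.le⟩
        · exact Finset.mem_filter.2 ⟨(Finset.mem_filter.1 hρ).1,
            (Finset.mem_filter.1 hρ).2.trans hyx.2.le⟩
    calc _ ≤ |sigPlus V (Circle.exp x) - sigMinus V (Circle.exp x)| +
          |sigMinus V (Circle.exp x) - sigPlus V 1| := abs_sub_le _ _ _
      _ ≤ _ := by linarith

/-- Inversion exchanges the points of `F` in the two open half circles and preserves `phiOdd`, as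
`f_ρ` depends only on `ρ + ρ⁻¹`. -/
theorem sum_upper_half {k : ℕ} {d : Fin k → ℝ[T;T⁻¹]} (F : Finset Circle)
    (hF : ∀ ρ, ρ ∈ F ↔ (ρ ≠ 1 ∧ ρ ≠ -1) ∧ phiOdd d ρ ≠ 0) :
    ∑ ρ ∈ F.filter (fun ρ : Circle => 0 < (ρ : ℂ).im), 2 * phiOdd d ρ = ∑ ρ ∈ F, phiOdd d ρ := by
  have him : ∀ ρ : Circle, (((ρ⁻¹ : Circle) : ℂ)).im = -(ρ : ℂ).im := fun ρ => by
    rw [Circle.coe_inv_eq_conj, Complex.conj_im]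
  have hinv : ∀ ρ ∈ F, ρ⁻¹ ∈ F := fun ρ hρ => by
    have h := (hF ρ).1 hρ
    refine (hF _).2 ⟨⟨inv_ne_one.2 h.1.1, ?_⟩, by rw [phiOdd_inv d h.1.1 h.1.2]; exact h.2⟩
    rw [Ne, inv_eq_iff_eq_inv, inv_neg, inv_one]
    exact h.1.2
  have hlow : ∑ ρ ∈ F.filter (fun ρ : Circle => ¬ 0 < (ρ : ℂ).im), phiOdd d ρ =
      ∑ ρ ∈ F.filter (fun ρ : Circle => 0 < (ρ : ℂ).im), phiOdd d ρ := by
    refine Finset.sum_nbij' (fun ρ => ρ⁻¹) (fun ρ => ρ⁻¹) ?_ ?_ ?_ ?_ ?_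
    · intro ρ hρ
      obtain ⟨h1, h2⟩ := Finset.mem_filter.1 hρ
      have h3 := (hF ρ).1 h1
      refine Finset.mem_filter.2 ⟨hinv ρ h1, ?_⟩
      rw [him]
      have := Circle.im_ne_zero h3.1.1 h3.1.2
      exact neg_pos.2 (lt_of_le_of_ne (not_lt.1 h2) this)
    · intro ρ hρ
      obtain ⟨h1, h2⟩ := Finset.mem_filter.1 hρ
      refine Finset.mem_filter.2 ⟨hinv ρ h1, ?_⟩
      rw [him]
      linarith
    · intro ρ _; exact inv_inv ρ
    · intro ρ _; exact inv_inv ρ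
    · intro ρ hρ
      have h3 := (hF ρ).1 (Finset.mem_filter.1 hρ).1
      exact (phiOdd_inv d h3.1.1 h3.1.2).symm
  rw [← Finset.sum_filter_add_sum_filter_not F (fun ρ : Circle => 0 < (ρ : ℂ).im), hlow,
    ← Finset.mul_sum, two_mul]

theorem sig_neg_one_bound {n : ℕ} {V : Matrix (Fin n) (Fin n) ℤ} {k : ℕ}
    {d : Fin k → ℝ[T;T⁻¹]} (hd : IsInvariantFactors V d) :
    |sig V (-1) - sigPlus V 1| ≤ (phiEven d (-1) : ℤ) +
      ((∑ᶠ ρ ∈ {ρ : Circle | ρ ≠ 1 ∧ ρ ≠ (-1)}, phiOdd d ρ : ℕ) : ℤ) := by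
  have hfin : ({ρ : Circle | ρ ≠ 1 ∧ ρ ≠ (-1)} ∩ {ρ : Circle | phiOdd d ρ ≠ 0}).Finite :=
    (finite_phiOdd hd.ne_zero).subset Set.inter_subset_right
  set F := hfin.toFinset with hFdef
  have hF : ∀ ρ, ρ ∈ F ↔ (ρ ≠ 1 ∧ ρ ≠ -1) ∧ phiOdd d ρ ≠ 0 := fun ρ => by
    rw [hFdef, Set.Finite.mem_toFinset]; rfl
  have hsum : ∑ᶠ ρ ∈ {ρ : Circle | ρ ≠ 1 ∧ ρ ≠ (-1)}, phiOdd d ρ = ∑ ρ ∈ F, phiOdd d ρ :=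
    finsum_mem_eq_sum (s := {ρ : Circle | ρ ≠ 1 ∧ ρ ≠ (-1)}) (f := fun ρ => phiOdd d ρ) hfin
  have hexp : Circle.exp Real.pi = -1 := Circle.ext (by simp)
  have hIco : Set.Ico 0 Real.pi ∈ 𝓝[<] Real.pi := Ico_mem_nhdsLT Real.pi_pos
  -- Just before the angle `π`, `sigPlus` already equals `σ⁻(-1)`; the remaining step to `σ(-1)` is
  -- `jumpMinus`.
  obtain ⟨y, hy, hyI⟩ := ((sigPlus_eventually_lt V Real.pi).and hIco).exists
  have h1 := abs_sigPlus_sub_le hd (F.filter fun ρ : Circle => 0 < (ρ : ℂ).im) (fun x hx h0 =>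
    Finset.mem_filter.2 ⟨(hF _).2 ⟨⟨Circle.exp_ne_one hx, Circle.exp_ne_neg_one hx⟩, h0⟩,
      Circle.exp_im_pos hx⟩) y hyI
  rw [hy, hexp] at h1
  have h2 : ∑ ρ ∈ (F.filter fun ρ : Circle => 0 < (ρ : ℂ).im).filter
      (fun ρ : Circle => (ρ : ℂ).arg ≤ y),
      2 * (phiOdd d ρ : ℤ) ≤
        ∑ ρ ∈ F.filter (fun ρ : Circle => 0 < (ρ : ℂ).im), 2 * (phiOdd d ρ : ℤ) :=
    Finset.sum_le_sum_of_subset_of_nonneg (Finset.filter_subset _ _) fun ρ _ _ => by positivity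
  have h3 : ∑ ρ ∈ F.filter (fun ρ : Circle => 0 < (ρ : ℂ).im), 2 * (phiOdd d ρ : ℤ) =
      ((∑ ρ ∈ F, phiOdd d ρ : ℕ) : ℤ) := by
    rw [← sum_upper_half F hF]; push_cast; rfl
  have h4 := (jumps_neg_one_bound hd).2.1
  have h5 : jumpMinus V (-1) = sig V (-1) - sigMinus V (-1) := by rw [jumpMinus]; ring
  rw [h5] at h4
  rw [hsum]
  calc _ ≤ |sig V (-1) - sigMinus V (-1)| + |sigMinus V (-1) - sigPlus V 1| := abs_sub_le _ _ _
    _ ≤ _ := by linarith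

end LinkSignature

theorem mainTheorem6 (L : LinkSignature.OrientedLink) {n : ℕ} (V : Matrix (Fin n) (Fin n) ℤ)
    (hV : LinkSignature.IsSeifertMatrix L V) {k : ℕ} (d : Fin k → LaurentPolynomial ℝ)
    (hd : LinkSignature.IsInvariantFactors V d) :
    -- the one-sided limits that define the jumps exist
    (∀ z : Circle,
      Filter.Tendsto (fun θ : ℝ => LinkSignature.sig V (z * Circle.exp θ)) (𝓝[>] 0)
        (𝓝 (LinkSignature.sigPlus V z)) ∧
      Filter.Tendsto (fun θ : ℝ => LinkSignature.sig V (z * Circle.exp θ)) (𝓝[<] 0)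
        (𝓝 (LinkSignature.sigMinus V z))) ∧
    (∀ ρ : Circle, ρ ≠ 1 → ρ ≠ (-1) →
      |LinkSignature.jump V ρ| ≤ 2 * (LinkSignature.phiOdd d ρ : ℤ) ∧
      |LinkSignature.jump V ρ| ≡ 2 * (LinkSignature.phiOdd d ρ : ℤ) [ZMOD 4]) ∧
    (|LinkSignature.jumpPlus V (-1)| ≤
        (LinkSignature.phiEven d (-1) : ℤ) ∧
      |LinkSignature.jumpPlus V (-1)| ≡
        (LinkSignature.phiEven d (-1) : ℤ) [ZMOD 2]) ∧
    (|LinkSignature.jumpMinus V (-1)| ≤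
        (LinkSignature.phiEven d (-1) : ℤ) ∧
      |LinkSignature.jumpMinus V (-1)| ≡
        (LinkSignature.phiEven d (-1) : ℤ) [ZMOD 2]) ∧
    -- the sum over the circle has only finitely many nonzero terms
    {ρ : Circle | LinkSignature.phiOdd d ρ ≠ 0}.Finite ∧
    |LinkSignature.sig V (-1) - LinkSignature.sigPlus V 1| ≤
      (LinkSignature.phiEven d (-1) : ℤ) +
        ((∑ᶠ ρ ∈ {ρ : Circle | ρ ≠ 1 ∧ ρ ≠ (-1)},
          LinkSignature.phiOdd d ρ : ℕ) : ℤ) := by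
  refine ⟨fun z => ?_, fun ρ h1 _ => LinkSignature.jump_bound h1 hd,
    (LinkSignature.jumps_neg_one_bound hd).1, (LinkSignature.jumps_neg_one_bound hd).2,
    LinkSignature.finite_phiOdd hd.ne_zero, LinkSignature.sig_neg_one_bound hd⟩
  obtain ⟨e, ε, H⟩ := LinkSignature.exists_isLocalForm V z
  rw [H.sigPlus_eq, H.sigMinus_eq]
  exact ⟨H.tendsto_right, H.tendsto_left⟩
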